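/- **Setting.** Let $\mathcal S,\mathcal A$ be finite, $H\ge 1$, and let $\phi:\mathcal S\times\mathcal A\to\mathbb R^d$ be a known feature mapping with $\phi_i(s,a)\ge 0$ and $\sum_i\phi_i(s,a)=1$. A $d$-rectangular linear RRMDP $M$ over $\phi$ is given by reward vectors $\theta_h\in\mathbb R^d$ with $\|\theta_h\|_2\le\sqrt d$ and $r_h(s,a)=\langle\phi(s,a),\theta_h\rangle\in[0,1]$, and nominal factor distributions $\mu^0_{h,i}\in\Delta(\mathcal S)$, with nominal kernel $P^0_h(\cdot|s,a)=\sum_i\phi_i(s,a)\mu^0_{h,i}$, for $h\in[H]$, $i\in[d]$. For a regularizer $\lambda>0$, a divergence $D\in\{\mathrm{TV},\mathrm{KL},\chi^2\}$ (the $f$-divergences with $f(x)=|x-1|/2,\ x\log x,\ (x-1)^2$; KL and $\chi^2$ are $+\infty$ without absolute continuity) and a randomized Markov policy $\pi$, put $$V_h^{\pi,\lambda}(s)=\inf_{\mu_t\in\Delta(\mathcal S)^d,\ P_t=\langle\phi,\mu_t\rangle}\mathbb E^{\pi,P}\Big[\sum_{t=h}^H\Big(r_t(s_t,a_t)+\lambda\sum_{i=1}^d\phi_i(s_t,a_t)D(\mu_{t,i}\|\mu^0_{t,i})\Big)\,\Big|\,s_h=s\Big],$$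 $V_h^{\star,\lambda}(s)=\sup_\pi V_h^{\pi,\lambda}(s)$, $V^{\star,\lambda}_{H+1}=0$, and $\mathrm{SubOpt}(M,\pi,s,\lambda,D)=V_1^{\star,\lambda}(s)-V_1^{\pi,\lambda}(s)$. A policy $\pi^\star$ is optimal if $V_1^{\pi^\star,\lambda}(s)=V_1^{\star,\lambda}(s)$ for all $s$. The robustly admissible set $\mathcal U^\lambda(P^0)$ consists of all kernels $P$ such that, separately for every $(h,s,a)$, $P_h(\cdot|s,a)=\sum_i\phi_i(s,a)\mu_i$ for some $\mu_i\in\Delta(\mathcal S)$ with $D(\mu_i\|\mu^0_{h,i})\le\max_{s'}V^{\star,\lambda}_{h+1}(s')/\lambda$ for all $i$. An offline dataset $\mathcal D$ of size $K$ with initial law $\rho$ and behavior policy $\pi^b$ consists of $K$ i.i.d. trajectories $(s_h^\tau,a_h^\tau,r_h^\tau)_{h\in[H]}$ with $s^\tau_1\sim\rho$, $a^\tau_h\sim\pi^b_h(\cdot|s^\tau_h)$, $s^\tau_{h+1}\sim P^0_h(\cdot|s^\tau_h,a^\tau_h)$, and rewards observed with noise, $r_h^\tau\sim\mathcal N(r_h(s_h^\tau,a_h^\tau),1)$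 independently; $\mathbb Q_M$ is its law under $M$. Put $\Lambda_h=I+\sum_{\tau=1}^K\phi(s_h^\tau,a_h^\tau)\phi(s_h^\tau,a_h^\tau)^\top$ and $$\mathcal E_M(\pi^\star,s;\mathcal D)=\sup_{P\in\mathcal U^\lambda(P^0)}\sum_{h=1}^H\mathbb E^{\pi^\star,P}\Big[\sum_{i=1}^d\|\phi_i(s_h,a_h)\mathbf 1_i\|_{\Lambda_h^{-1}}\,\Big|\,s_1=s\Big],$$ where $\mathbf 1_i$ is the $i$-th basis vector and $\|v\|_B=\sqrt{v^\top Bv}$. For a class $\mathcal M$ of RRMDPs over $\phi$, the minimax suboptimality is $$\mathfrak R(s,D)=\inf_{\hat\pi}\sup_{M\in\mathcal M}\mathbb E_{\mathcal D\sim\mathbb Q_M}\big[\mathrm{SubOpt}(M,\hat\pi(\mathcal D),s,\lambda,D)\big],$$ the infimum being over all measurable maps $\hat\pi$ from datasets to policies. **Theorem.** There are universal constants $c,C_0>0$ such that for all $d\ge 2$, $H\ge1$, $K\in\mathbb N$ and $\lambda>0$ there exist finite $\mathcal S,\mathcal A$, a feature mapping $\phi$, a class $\mathcal M$ of $d$-rectangular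 linear RRMDPs over $\phi$, an initial law $\rho$ and a behavior policy $\pi^b$ for which the following holds. For every $\delta\in(0,1)$ with $$K>C_0\max\Big\{d^6,\frac{d^3H^2}{\lambda^2}\Big\}\log\frac{dH}{\delta},$$ every $s\in\mathcal S$ and every $D\in\{\mathrm{TV},\mathrm{KL},\chi^2\}$: 1. $\mathfrak R(s,D)\ge c\,d^{3/2}H/\sqrt K$; 2. for every $M\in\mathcal M$ and every optimal policy $\pi^\star$ of $M$, with $\mathbb Q_M$-probability at least $1-\delta$ over the dataset, both $$\mathfrak R(s,D)\ \ge\ c\cdot\mathcal E_M(\pi^\star,s;\mathcal D)\qquad\text{and}\qquad c\cdot\mathcal E_M(\pi^\star,s;\mathcal D)\le \frac{d^{3/2}H}{\sqrt K}.$$ -/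

import Mathlib

open MeasureTheory ProbabilityTheory
open scoped ENNReal

noncomputable section

namespace RobustMDP

/-- A randomized Markov policy on the horizon `H`: the step `h` and the current state give a
probability vector on the actions. Steps are numbered `0, …, H - 1`. -/
abbrev Policy (S A : Type) [Fintype A] (H : ℕ) : Type :=
  Fin H → S → stdSimplex ℝ A

/-- Time-dependent transition probabilities `P h s a s'`. -/
abbrev Transition (S A : Type) (H : ℕ) : Type :=
  Fin H → S → A → S → ℝ

/-- The three divergences. -/
inductive Divergence
  | tv
  | kl
  | chiSq

section Divergences

variable {S : Type} [Fintype S]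

/-- The `f`-divergence `∑ₛ f (μ s / ν s) ν s`, which is `∞` unless `μ ≪ ν`. -/
def fDivergence (f : ℝ → ℝ) (μ ν : stdSimplex ℝ S) : ℝ≥0∞ :=
  open Classical in
  if ∀ s, ν.1 s = 0 → μ.1 s = 0 then
    ENNReal.ofReal (∑ s, f (μ.1 s / ν.1 s) * ν.1 s)
  else ∞

/-- Total variation distance, `f(x) = |x - 1| / 2` (extended as usual to pairs `μ, ν` without
absolute continuity), Kullback-Leibler divergence, `f(x) = x log x`, and chi-square divergence,
`f(x) = (x - 1)²`. -/
def Divergence.eval : Divergence → stdSimplex ℝ S → stdSimplex ℝ S → ℝ≥0∞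
  | .tv, μ, ν => ENNReal.ofReal ((∑ s, |μ.1 s - ν.1 s|) / 2)
  | .kl, μ, ν => fDivergence (fun x => x * Real.log x) μ ν
  | .chiSq, μ, ν => fDivergence (fun x => (x - 1) ^ 2) μ ν

end Divergences

/-- A feature mapping with values in the probability simplex of `ℝ^d`. -/
structure FeatureMap (S A : Type) (d : ℕ) where
  feat : S → A → Fin d → ℝ
  feat_nonneg : ∀ s a i, 0 ≤ feat s a i
  feat_sum : ∀ s a, ∑ i, feat s a i = 1

/-- The data of a `d`-rectangular linear RRMDP over the (known) feature mapping `φ`: the reward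
parameters and the nominal factor distributions. -/
structure LinearRRMDP {S A : Type} [Fintype S] {d : ℕ} (φ : FeatureMap S A d) (H : ℕ) where
  θ : Fin H → EuclideanSpace ℝ (Fin d)
  μ₀ : Fin H → Fin d → stdSimplex ℝ S
  θ_norm : ∀ h, ‖θ h‖ ≤ Real.sqrt d
  reward_mem : ∀ h s a, ∑ i, φ.feat s a i * θ h i ∈ Set.Icc (0 : ℝ) 1

section Expectation

variable {S A : Type} [Fintype S] [Fintype A] {H : ℕ}

/-- `E^{π,P}[∑_{t = h}^{H-1} g t (s_t) (a_t) | s_h = s]`, for a nonnegative cost `g`. -/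
def expectedSum (π : Policy S A H) (P : Transition S A H) (g : Fin H → S → A → ℝ≥0∞)
    (h : ℕ) (s : S) : ℝ≥0∞ :=
  if hh : h < H then
    ∑ a, ENNReal.ofReal ((π ⟨h, hh⟩ s).1 a) *
      (g ⟨h, hh⟩ s a +
        ∑ s', ENNReal.ofReal (P ⟨h, hh⟩ s a s') * expectedSum π P g (h + 1) s')
  else 0
termination_by H - h

/-- Probability of a state-action path when the initial state has law `ρ`, the actions follow `π`
and the transitions follow `P`. -/
def pathWeight (ρ : stdSimplex ℝ S) (π : Policy S A H) (P : Transition S A H)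
    (τ : Fin H → S × A) : ℝ :=
  ∏ h : Fin H,
    (if h.1 = 0 then ρ.1 (τ h).1
      else
        let p : Fin H := ⟨h.1 - 1, lt_of_le_of_lt (Nat.sub_le _ _) h.2⟩
        P p (τ p).1 (τ p).2 (τ h).1) *
      (π h (τ h).1).1 (τ h).2

end Expectation

/-- `K` trajectories, each a sequence of `H` triples (state, action, observed reward). -/
abbrev Dataset (S A : Type) (H K : ℕ) : Type :=
  Fin K → Fin H → (S × A) × ℝ

namespace LinearRRMDP

variable {S A : Type} [Fintype S] [Fintype A] {d H : ℕ} {φ : FeatureMap S A d}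

/-- `r_h(s,a) = ⟨φ(s,a), θ_h⟩`. -/
def reward (M : LinearRRMDP φ H) (h : Fin H) (s : S) (a : A) : ℝ :=
  ∑ i, φ.feat s a i * M.θ h i

/-- The transition probabilities `P_h(· | s,a) = ⟨φ(s,a), μ_h(·)⟩`. -/
def linearTransition (φ : FeatureMap S A d) (μ : Fin H → Fin d → stdSimplex ℝ S) :
    Transition S A H :=
  fun h s a s' => ∑ i, φ.feat s a i * (μ h i).1 s'

/-- The robust regularized value function: the infimum, over all factor distributions `μ`, of
`E^{π,P}[∑_{t ≥ h} (r_t(s_t,a_t) + lam ⟨φ(s_t,a_t), D(μ_t ‖ μ⁰_t)⟩) | s_h = s]` with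
`P = ⟨φ, μ⟩`. -/
def value (M : LinearRRMDP φ H) (lam : ℝ) (D : Divergence) (π : Policy S A H)
    (h : ℕ) (s : S) : ℝ≥0∞ :=
  ⨅ μ : Fin H → Fin d → stdSimplex ℝ S,
    expectedSum π (linearTransition φ μ)
      (fun t s a => ENNReal.ofReal (M.reward t s a) +
        ENNReal.ofReal lam * ∑ i, ENNReal.ofReal (φ.feat s a i) * D.eval (μ t i) (M.μ₀ t i))
      h s

/-- The optimal robust regularized value function. -/
def optValue (M : LinearRRMDP φ H) (lam : ℝ) (D : Divergence) (h : ℕ) (s : S) : ℝ≥0∞ :=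
  ⨆ π : Policy S A H, M.value lam D π h s

/-- `π` attains the optimal value at the first step, from every state. -/
def IsOptimal (M : LinearRRMDP φ H) (lam : ℝ) (D : Divergence) (π : Policy S A H) : Prop :=
  ∀ s, M.value lam D π 0 s = M.optValue lam D 0 s

/-- The suboptimality gap. -/
def subOpt (M : LinearRRMDP φ H) (lam : ℝ) (D : Divergence) (π : Policy S A H) (s : S) : ℝ≥0∞ :=
  M.optValue lam D 0 s - M.value lam D π 0 s

/-- The robustly admissible set: independently for every `(h,s,a)`, the law of the next state is
`∑ᵢ φᵢ(s,a) μᵢ` with `D(μᵢ ‖ μ⁰_{h,i}) ≤ max_s V*_{h+1}(s) / lam` for all `i`. -/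
def admissible (M : LinearRRMDP φ H) (lam : ℝ) (D : Divergence) : Set (Transition S A H) :=
  {P | ∀ h s a, ∃ μ : Fin d → stdSimplex ℝ S,
    (∀ i, D.eval (μ i) (M.μ₀ h i) ≤
      (⨆ x : S, M.optValue lam D (h.1 + 1) x) / ENNReal.ofReal lam) ∧
    ∀ s', P h s a s' = ∑ i, φ.feat s a i * (μ i).1 s'}

/-- The law of one trajectory: initial law `ρ`, behavior policy `πb`, nominal transitions, and
rewards that are observed with independent standard Gaussian noise. -/
def trajectoryLaw [MeasurableSpace S] [MeasurableSpace A] (M : LinearRRMDP φ H)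
    (ρ : stdSimplex ℝ S) (πb : Policy S A H) : Measure (Fin H → (S × A) × ℝ) :=
  ∑ τ : Fin H → S × A,
    ENNReal.ofReal (pathWeight ρ πb (linearTransition φ M.μ₀) τ) •
      Measure.pi fun h =>
        (Measure.dirac (τ h)).prod (gaussianReal (M.reward h (τ h).1 (τ h).2) 1)

/-- The law of `K` independent trajectories. -/
def datasetLaw [MeasurableSpace S] [MeasurableSpace A] (M : LinearRRMDP φ H)
    (ρ : stdSimplex ℝ S) (πb : Policy S A H) (K : ℕ) : Measure (Dataset S A H K) :=
  Measure.pi fun _ => M.trajectoryLaw ρ πb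

end LinearRRMDP

section Uncertainty

variable {S A : Type} {d H K : ℕ}

/-- `Λ_h = I + ∑_τ φ(s_h^τ, a_h^τ) φ(s_h^τ, a_h^τ)ᵀ`. -/
def gram (φ : FeatureMap S A d) (x : Dataset S A H K) (h : Fin H) : Matrix (Fin d) (Fin d) ℝ :=
  1 + ∑ k, Matrix.vecMulVec (φ.feat (x k h).1.1 (x k h).1.2) (φ.feat (x k h).1.1 (x k h).1.2)

/-- `∑ᵢ ‖φᵢ(s,a) 1ᵢ‖_{Λ_h⁻¹}`, where `1ᵢ` is the `i`-th basis vector and `‖v‖_B = √(vᵀ B v)`. -/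
def featureUncertainty (φ : FeatureMap S A d) (x : Dataset S A H K) (h : Fin H) (s : S) (a : A) :
    ℝ :=
  ∑ i, Real.sqrt
    (Pi.single i (φ.feat s a i) ⬝ᵥ Matrix.mulVec (gram φ x h)⁻¹ (Pi.single i (φ.feat s a i)))

/-- `sup_{P ∈ U(P⁰)} ∑_h E^{π,P}[∑ᵢ ‖φᵢ(s_h,a_h) 1ᵢ‖_{Λ_h⁻¹} | s_1 = s]`. -/
def uncertainty [Fintype S] [Fintype A] {φ : FeatureMap S A d} (M : LinearRRMDP φ H) (lam : ℝ)
    (D : Divergence) (π : Policy S A H) (s : S) (x : Dataset S A H K) : ℝ≥0∞ :=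
  ⨆ P ∈ M.admissible lam D,
    expectedSum π P (fun h s a => ENNReal.ofReal (featureUncertainty φ x h s a)) 0 s

/-- The minimax suboptimality over the class `C`: the infimum, over all learning rules (measurable
maps from datasets to policies), of the largest expected suboptimality gap over the class, where
under the instance `M` the dataset is drawn from `M`. -/
def minimaxSubOpt [Fintype S] [Fintype A] [MeasurableSpace S] [MeasurableSpace A]
    {φ : FeatureMap S A d} (C : Set (LinearRRMDP φ H)) (ρ : stdSimplex ℝ S) (πb : Policy S A H)
    (K : ℕ) (lam : ℝ) (D : Divergence) (s : S) : ℝ≥0∞ :=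
  ⨅ (πhat : Dataset S A H K → Policy S A H) (_ : Measurable πhat),
    ⨆ M ∈ C, ∫⁻ x, M.subOpt lam D (πhat x) s ∂(M.datasetLaw ρ πb K)

end Uncertainty

end RobustMDP

end

/-!
The class of hard instances has two states and the actions `{0,1}ⁿ`, `n = d - 1`. A bit of the
action moves weight of order `1 / n` from a base factor to one of `n` further factors, whose reward
parameter is larger or smaller than that of the base factor by `ε`, according to a hidden bit
`ξ h i`; in the state `1` the actions have half of their effect, and the nominal laws of the base
factor and of the other factors differ, so that rewards and transitions depend on state and action,
but the nominal laws do not depend on `ξ`. The behavior policy plays the zero action half of the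
time and otherwise sets a single random bit, so a hidden bit is probed by a fraction `1 / (2 n)` of
the data and moves the observed mean by `ε / n` only. It stays hidden as long as
`ε² ≲ n³ / K`, and all `n` bits together are worth `n · ε / n = ε` per step, which is the rate.

Lower bound. Let `W` be the nominal value of the greedy policy of `ξ`.
* The value of any policy is at most its nominal value, which is at most `W` minus the expected
  number of wrong bits times `ε / (4 n)`. This uses that `W` varies over the states by at most `ε`
  (`openLoopValue_spread`), hence that transitions never outweigh rewards, and that every transition
  reaches the state `0` with probability at least `1 / 4` (`value_hardInstance_le`).
* The optimal robust value is at least `W` minus `3 ε² / lam` per step, as all three divergences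
  dominate a multiple of the squared change of mass (`le_optValue_hardInstance`). Since
  `K ≳ d³ / lam²`, this loss is a small multiple of `ε`.
* Flipping one bit of `ξ` changes the law of the dataset by a likelihood ratio with second moment at
  most `2`, so no test recovers the bit (`half_le_testing_error`,
  `lintegral_datasetRatio_flipBit_sq_le`), and averaging over `ξ` gives `le_minimaxSubOpt_add`.

Upper bound on the uncertainty. The features are convex weights, so the uncertainty of any policy
under any kernel is at most `H` times the largest square root of a diagonal entry of an inverse Gram
matrix (`uncertainty_le`). Once every probing action occurs about as often as expected, which is a
Chernoff bound, these entries are of order `n³ / K` (`sq_le_gram`). So the uncertainty is bounded by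
the rate, and by the first part also by a multiple of the minimax suboptimality.
-/

namespace RobustMDP

/-! ### Products of measures, Gaussian likelihood ratios and testing -/

theorem lintegral_pi_prod {n : ℕ} {E : Type*} [MeasurableSpace E] (μ : Fin n → Measure E)
    [∀ i, SigmaFinite (μ i)] (f : Fin n → E → ℝ≥0∞) (hf : ∀ i, Measurable (f i)) :
    ∫⁻ x : Fin n → E, ∏ i, f i (x i) ∂Measure.pi μ = ∏ i, ∫⁻ x, f i x ∂μ i := by
  induction n with
  | zero => simp
  | succ n ih =>
    rw [← ((measurePreserving_piFinSuccAbove μ 0).symm).lintegral_comp_emb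
      (MeasurableEquiv.measurableEmbedding _)]
    simp_rw [MeasurableEquiv.piFinSuccAbove_symm_apply, Fin.insertNthEquiv,
      Fin.prod_univ_succ, Fin.insertNth_zero]
    simp only [Fin.zero_succAbove, Equiv.coe_fn_mk, Fin.cons_zero, Fin.cons_succ,
      cast_eq]
    rw [lintegral_prod_mul (f := f 0) (g := fun y : Fin n → E => ∏ i, f i.succ (y i))
      (hf 0).aemeasurable, ih _ _ fun i => hf i.succ]
    exact (Finset.measurable_fun_prod _
      fun i _ => (hf i.succ).comp (measurable_pi_apply i)).aemeasurable

/-- Densities of the factors multiply to a density of the product measure. -/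
theorem pi_withDensity {n : ℕ} {E : Type*} [MeasurableSpace E] (μ μ' : Fin n → Measure E)
    [∀ i, SigmaFinite (μ i)] [∀ i, SigmaFinite (μ' i)] (f : Fin n → E → ℝ≥0∞)
    (hf : ∀ i, Measurable (f i)) (h : ∀ i, μ' i = (μ i).withDensity (f i)) :
    Measure.pi μ' = (Measure.pi μ).withDensity fun x => ∏ i, f i (x i) := by
  refine Measure.pi_eq fun s hs => ?_
  rw [withDensity_apply _ (MeasurableSet.univ_pi hs), ← lintegral_indicator
    (MeasurableSet.univ_pi hs)]
  calc _ = ∫⁻ x : Fin n → E, ∏ i, (s i).indicator (f i) (x i) ∂Measure.pi μ := by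
        refine lintegral_congr fun x => ?_
        by_cases hx : x ∈ Set.univ.pi s
        · rw [Set.indicator_of_mem hx]
          exact Finset.prod_congr rfl fun i _ =>
            (Set.indicator_of_mem (hx i (Set.mem_univ i)) _).symm
        · rw [Set.indicator_of_notMem hx]
          obtain ⟨i, hi⟩ : ∃ i, x i ∉ s i := by simpa using hx
          exact (Finset.prod_eq_zero (Finset.mem_univ i) (Set.indicator_of_notMem hi _)).symm
    _ = _ := by
        rw [lintegral_pi_prod _ _ fun i => (hf i).indicator (hs i)]
        refine Finset.prod_congr rfl fun i _ => ?_
        rw [h i, withDensity_apply _ (hs i), lintegral_indicator (hs i)]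

/-- The likelihood ratio of `N(m + δ, 1)` to `N(m, 1)`. -/
noncomputable def gaussianRatio (m δ r : ℝ) : ℝ≥0∞ :=
  ENNReal.ofReal (Real.exp (δ * (r - m) - δ ^ 2 / 2))

theorem measurable_gaussianRatio (m δ : ℝ) : Measurable (gaussianRatio m δ) := by
  unfold gaussianRatio; fun_prop

theorem gaussianReal_add_eq_withDensity (m δ : ℝ) :
    gaussianReal (m + δ) 1 = (gaussianReal m 1).withDensity (gaussianRatio m δ) := by
  rw [gaussianReal_of_var_ne_zero _ one_ne_zero, gaussianReal_of_var_ne_zero _ one_ne_zero,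
    ← withDensity_mul _ (measurable_gaussianPDF _ _) (measurable_gaussianRatio _ _)]
  congr 1
  ext r
  rw [Pi.mul_apply, gaussianPDF_def, gaussianPDF_def, gaussianRatio,
    ← ENNReal.ofReal_mul (gaussianPDFReal_nonneg _ _ _), gaussianPDFReal_def, gaussianPDFReal_def]
  beta_reduce
  rw [mul_assoc (_)⁻¹, ← Real.exp_add]
  congr 3
  push_cast
  ring

theorem lintegral_gaussianRatio (m δ : ℝ) : ∫⁻ r, gaussianRatio m δ r ∂gaussianReal m 1 = 1 := by
  rw [← setLIntegral_univ, ← withDensity_apply _ MeasurableSet.univ,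
    ← gaussianReal_add_eq_withDensity, measure_univ]

/-- The square of the likelihood ratio for `δ` is `exp δ²` times the one for `2 δ`. -/
theorem lintegral_gaussianRatio_sq (m δ : ℝ) :
    ∫⁻ r, gaussianRatio m δ r ^ 2 ∂gaussianReal m 1 = ENNReal.ofReal (Real.exp (δ ^ 2)) := by
  have h : ∀ r, gaussianRatio m δ r ^ 2 =
      ENNReal.ofReal (Real.exp (δ ^ 2)) * gaussianRatio m (2 * δ) r := fun r => by
    rw [gaussianRatio, gaussianRatio, ← ENNReal.ofReal_pow (Real.exp_nonneg _),
      ← ENNReal.ofReal_mul (Real.exp_nonneg _), ← Real.exp_add, ← Real.exp_nat_mul]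
    congr 2
    push_cast
    ring
  simp_rw [h]
  rw [lintegral_const_mul _ (measurable_gaussianRatio _ _), lintegral_gaussianRatio, mul_one]

/-- Two-point testing: if the likelihood ratio `L` has second moment at most `2`, then a randomized
test `f, g` cannot tell `Q` from `L • Q`. -/
theorem half_le_testing_error {Ω : Type*} [MeasurableSpace Ω] (Q : Measure Ω) (L f g : Ω → ℝ≥0∞)
    (hL : Measurable L) (hf : Measurable f) (hg : Measurable g) (hfg : ∀ x, f x + g x = 1)
    (h1 : ∫⁻ x, L x ∂Q = 1) (h2 : ∫⁻ x, L x ^ 2 ∂Q ≤ 2) :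
    1 / 2 ≤ ∫⁻ x, f x ∂Q + ∫⁻ x, g x ∂(Q.withDensity L) := by
  -- `f L ≤ f + L² / 4` as `f ≤ 1`, by the arithmetic-geometric mean inequality.
  have key : ∀ x, L x ≤ f x + L x * g x + 4⁻¹ * L x ^ 2 := fun x => by
    by_cases htop : L x = ∞
    · rw [htop]; simp [ENNReal.top_pow]
    have hf1 : f x ≤ 1 := hfg x ▸ le_self_add
    have hfL : f x * L x ≤ f x + 4⁻¹ * L x ^ 2 := by
      lift L x to NNReal using htop with l
      lift f x to NNReal using ne_top_of_le_ne_top ENNReal.one_ne_top hf1 with p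
      have h4 : (4⁻¹ : ℝ≥0∞) = ((4⁻¹ : NNReal) : ℝ≥0∞) := by
        rw [ENNReal.coe_inv (by norm_num)]; rfl
      rw [h4]
      norm_cast
      norm_cast at hf1
      rw [← NNReal.coe_le_coe]
      push_cast
      have hp : (p : ℝ) ≤ 1 := hf1
      nlinarith [sq_nonneg ((p : ℝ) - l / 2), p.2, mul_nonneg p.2 (sub_nonneg.2 hp)]
    calc L x = f x * L x + L x * g x := by rw [mul_comm (L x), ← add_mul, hfg, one_mul]
      _ ≤ (f x + 4⁻¹ * L x ^ 2) + L x * g x := by gcongr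
      _ = _ := by ring
  have hint : (1 : ℝ≥0∞) ≤ (∫⁻ x, f x ∂Q + ∫⁻ x, g x ∂(Q.withDensity L)) + 1 / 2 := by
    rw [lintegral_withDensity_eq_lintegral_mul _ hL hg]
    calc (1 : ℝ≥0∞) = ∫⁻ x, L x ∂Q := h1.symm
      _ ≤ ∫⁻ x, (f x + L x * g x + 4⁻¹ * L x ^ 2) ∂Q := lintegral_mono key
      _ = ∫⁻ x, f x ∂Q + ∫⁻ x, L x * g x ∂Q + 4⁻¹ * ∫⁻ x, L x ^ 2 ∂Q := by
        rw [lintegral_add_left (by fun_prop), lintegral_add_left hf, lintegral_const_mul _ (by fun_prop)]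
      _ ≤ ∫⁻ x, f x ∂Q + ∫⁻ x, L x * g x ∂Q + 4⁻¹ * 2 := by gcongr
      _ = _ := by
        have : (4⁻¹ : ℝ≥0∞) * 2 = 1 / 2 := by
          rw [show (4 : ℝ≥0∞) = 2 * 2 by norm_num, ENNReal.mul_inv (by simp) (by simp), mul_assoc,
            ENNReal.inv_mul_cancel (by simp) (by simp), mul_one, one_div]
        rw [this]; rfl
  refine ENNReal.le_of_add_le_add_right (a := 1 / 2) (by simp) ?_
  rwa [ENNReal.add_halves]

/-! ### Dynamic programming and divergences -/

section Dynamic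

variable {S A : Type} [Fintype S] [Fintype A] {H : ℕ}

theorem expectedSum_of_lt (π : Policy S A H) (P : Transition S A H) (g : Fin H → S → A → ℝ≥0∞)
    (h : Fin H) (s : S) :
    expectedSum π P g h s = ∑ a, ENNReal.ofReal ((π h s).1 a) *
      (g h s a + ∑ s', ENNReal.ofReal (P h s a s') * expectedSum π P g (h + 1) s') := by
  rw [expectedSum, dif_pos h.2]

theorem expectedSum_of_ge (π : Policy S A H) (P : Transition S A H) (g : Fin H → S → A → ℝ≥0∞)
    {h : ℕ} (hh : H ≤ h) (s : S) : expectedSum π P g h s = 0 := by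
  rw [expectedSum, dif_neg hh.not_gt]

/-- Backward induction over the steps `H, H - 1, …, 0`. -/
theorem backward_induction {p : ℕ → Prop} (base : p H) (step : ∀ h : Fin H, p (h + 1) → p h) :
    ∀ h ≤ H, p h := fun _ hh =>
  Nat.decreasingInduction (motive := fun k _ => p k) (fun k hk ih => step ⟨k, hk⟩ ih) base hh

/-- Comparison from above: the expected cost is at most any function that decreases along the
Bellman recursion. -/
theorem expectedSum_le_of_supersolution (π : Policy S A H) (P : Transition S A H)
    (g : Fin H → S → A → ℝ) (U : ℕ → S → ℝ) (hP : ∀ h s a s', 0 ≤ P h s a s')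
    (hg : ∀ h s a, 0 ≤ g h s a) (hUH : ∀ s, 0 ≤ U H s)
    (hU : ∀ (h : Fin H) s,
      ∑ a, (π h s).1 a * (g h s a + ∑ s', P h s a s' * U (h + 1) s') ≤ U h s) :
    ∀ h ≤ H, ∀ s, 0 ≤ U h s ∧
      expectedSum π P (fun h s a => ENNReal.ofReal (g h s a)) h s ≤ ENNReal.ofReal (U h s) := by
  refine backward_induction (fun s => ⟨hUH s, ?_⟩) fun h ih s => ?_
  · rw [expectedSum_of_ge _ _ _ le_rfl]; exact zero_le
  have hin : ∀ a, 0 ≤ ∑ s', P h s a s' * U (h + 1) s' := fun a =>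
    Finset.sum_nonneg fun s' _ => mul_nonneg (hP _ _ _ _) (ih s').1
  have hterm : ∀ a, 0 ≤ (π h s).1 a * (g h s a + ∑ s', P h s a s' * U (h + 1) s') := fun a =>
    mul_nonneg ((π h s).2.1 a) (add_nonneg (hg _ _ _) (hin a))
  refine ⟨(Finset.sum_nonneg fun a _ => hterm a).trans (hU h s), ?_⟩
  rw [expectedSum_of_lt]
  refine le_trans ?_ (ENNReal.ofReal_le_ofReal (hU h s))
  rw [ENNReal.ofReal_sum_of_nonneg fun a _ => hterm a]
  refine Finset.sum_le_sum fun a _ => ?_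
  rw [ENNReal.ofReal_mul ((π h s).2.1 a), ENNReal.ofReal_add (hg _ _ _) (hin a),
    ENNReal.ofReal_sum_of_nonneg fun s' _ => mul_nonneg (hP _ _ _ _) (ih s').1]
  gcongr with s' _
  rw [ENNReal.ofReal_mul (hP _ _ _ _)]
  gcongr
  exact (ih s').2

theorem ofReal_sum_le {ι : Type*} (t : Finset ι) (f : ι → ℝ) :
    ENNReal.ofReal (∑ i ∈ t, f i) ≤ ∑ i ∈ t, ENNReal.ofReal (f i) := by
  classical
  induction t using Finset.induction_on with
  | empty => simp
  | insert i t hi ih =>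
    rw [Finset.sum_insert hi, Finset.sum_insert hi]
    exact ENNReal.ofReal_add_le.trans (by gcongr)

/-- Comparison from below, for costs `g` that may be infinite and are bounded below by `γ`. -/
theorem ofReal_le_expectedSum_of_subsolution (π : Policy S A H) (P : Transition S A H)
    (g : Fin H → S → A → ℝ≥0∞) (γ : Fin H → S → A → ℝ) (U : ℕ → S → ℝ)
    (hP : ∀ h s a s', 0 ≤ P h s a s') (hg : ∀ h s a, ENNReal.ofReal (γ h s a) ≤ g h s a)
    (hUH : ∀ s, U H s ≤ 0)
    (hU : ∀ (h : Fin H) s,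
      U h s ≤ ∑ a, (π h s).1 a * (γ h s a + ∑ s', P h s a s' * U (h + 1) s')) :
    ∀ h ≤ H, ∀ s, ENNReal.ofReal (U h s) ≤ expectedSum π P g h s := by
  refine backward_induction (fun s => ?_) fun h ih s => ?_
  · rw [ENNReal.ofReal_of_nonpos (hUH s)]; exact zero_le
  rw [expectedSum_of_lt]
  refine (ENNReal.ofReal_le_ofReal (hU h s)).trans ((ofReal_sum_le _ _).trans ?_)
  refine Finset.sum_le_sum fun a _ => ?_
  rw [ENNReal.ofReal_mul ((π h s).2.1 a)]
  gcongr
  refine ENNReal.ofReal_add_le.trans (add_le_add (hg h s a) ((ofReal_sum_le _ _).trans ?_))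
  refine Finset.sum_le_sum fun s' _ => ?_
  rw [ENNReal.ofReal_mul (hP _ _ _ _)]
  gcongr
  exact ih s'

theorem expectedSum_le_of_cost_le (π : Policy S A H) (P : Transition S A H)
    (g : Fin H → S → A → ℝ) {B : ℝ} (hP : ∀ h s a s', 0 ≤ P h s a s')
    (hP1 : ∀ h s a, ∑ s', P h s a s' = 1) (hg : ∀ h s a, 0 ≤ g h s a)
    (hB : ∀ h s a, g h s a ≤ B) (s : S) :
    expectedSum π P (fun h s a => ENNReal.ofReal (g h s a)) 0 s ≤ ENNReal.ofReal (H * B) := by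
  have := (expectedSum_le_of_supersolution π P g (fun h _ => ((H : ℝ) - h) * B) hP hg
    (by simp) (fun h s => ?_) 0 (Nat.zero_le _) s).2
  · simpa using this
  · calc _ ≤ ∑ a, (π h s).1 a * (B + ((H : ℝ) - (h + 1)) * B) := by
          refine Finset.sum_le_sum fun a _ => mul_le_mul_of_nonneg_left ?_ ((π h s).2.1 a)
          rw [← Finset.sum_mul, hP1, one_mul]
          push_cast
          linarith [hB h s a]
      _ = _ := by rw [← Finset.sum_mul, (π h s).2.2]; ring

end Dynamic

section Divergences

variable {S : Type} [Fintype S]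

theorem Divergence.eval_self (D : Divergence) (ν : stdSimplex ℝ S) : D.eval ν ν = 0 := by
  have hf : ∀ f : ℝ → ℝ, f 1 = 0 → fDivergence f ν ν = 0 := fun f hf => by
    rw [fDivergence, if_pos fun _ h => h, Finset.sum_eq_zero, ENNReal.ofReal_zero]
    intro s _
    rcases eq_or_ne (ν.1 s) 0 with h | h
    · rw [h, mul_zero]
    · rw [div_self h, hf, zero_mul]
  cases D
  · simp [Divergence.eval]
  · rw [Divergence.eval, hf _ (by simp)]
  · rw [Divergence.eval, hf _ (by simp)]

/-- A quadratic lower bound for the integrand of the Kullback-Leibler divergence. -/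
theorem sub_one_sq_le_mul_log {x : ℝ} (hx : 0 ≤ x) (hx4 : x ≤ 4) :
    (x - 1) ^ 2 / 9 ≤ x * Real.log x - (x - 1) := by
  rcases hx.eq_or_lt with rfl | hx0
  · norm_num
  -- Since `log x = 2 log √x ≥ 2 (1 - 1 / √x)`, the right side is at least `(√x - 1)²`.
  set y := Real.sqrt x with hy
  have hy0 : 0 < y := Real.sqrt_pos.2 hx0
  have hxy : x = y ^ 2 := (Real.sq_sqrt hx).symm
  have hy2 : y ≤ 2 := by nlinarith
  have hlog : 1 - y⁻¹ ≤ Real.log y := Real.one_sub_inv_le_log_of_pos hy0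
  have h1 : y ^ 2 * (2 * (1 - y⁻¹)) ≤ x * Real.log x := by
    rw [hxy, Real.log_pow]; push_cast; gcongr
  have h2 : y ^ 2 * (2 * (1 - y⁻¹)) = 2 * y ^ 2 - 2 * y := by field_simp
  have h3 : (x - 1) ^ 2 ≤ 9 * (y - 1) ^ 2 := by
    have : (y + 1) ^ 2 ≤ 9 := by nlinarith
    rw [hxy, show y ^ 2 - 1 = (y + 1) * (y - 1) by ring, mul_pow]
    gcongr
  rw [hxy] at h3 ⊢
  rw [hxy] at h1
  linarith [h3, h1, h2, show (y - 1) ^ 2 = y ^ 2 - 2 * y + 1 by ring]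

/-- A common quadratic lower bound for the three divergences: a weak form of Pinsker's inequality
for a reference law with masses at least `1 / 4`. -/
theorem Divergence.sq_le_eval (D : Divergence) (μ ν : stdSimplex ℝ S) (hν : ∀ s, 1 / 4 ≤ ν.1 s)
    (s : S) : ENNReal.ofReal ((μ.1 s - ν.1 s) ^ 2 / 9) ≤ D.eval μ ν := by
  have hμ0 := μ.2.1
  have hμ1 : ∀ s, μ.1 s ≤ 1 := fun s => by
    rw [← μ.2.2]; exact Finset.single_le_sum (fun i _ => hμ0 i) (Finset.mem_univ s)
  have hν1 : ∀ s, ν.1 s ≤ 1 := fun s => by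
    rw [← ν.2.2]; exact Finset.single_le_sum (fun i _ => ν.2.1 i) (Finset.mem_univ s)
  have hν0 : ∀ s, 0 < ν.1 s := fun s => by linarith [hν s]
  have hmul : ∀ s, μ.1 s / ν.1 s * ν.1 s = μ.1 s := fun s => div_mul_cancel₀ _ (hν0 s).ne'
  have hchi : ∀ s, (μ.1 s - ν.1 s) ^ 2 ≤ (μ.1 s / ν.1 s - 1) ^ 2 * ν.1 s := fun s => by
    have : μ.1 s / ν.1 s - 1 = (μ.1 s - ν.1 s) / ν.1 s := by
      rw [sub_div, div_self (hν0 s).ne']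
    rw [this, div_pow, sq (ν.1 s), ← div_div, div_mul_cancel₀ _ (hν0 s).ne']
    exact le_div_self (sq_nonneg _) (hν0 s) (hν1 s)
  have hsum : (μ.1 s - ν.1 s) ^ 2 ≤ ∑ s, (μ.1 s / ν.1 s - 1) ^ 2 * ν.1 s :=
    (hchi s).trans (Finset.single_le_sum
      (f := fun s => (μ.1 s / ν.1 s - 1) ^ 2 * ν.1 s)
      (fun i _ => mul_nonneg (sq_nonneg _) (hν0 i).le) (Finset.mem_univ s))
  cases D
  · refine ENNReal.ofReal_le_ofReal ?_
    have h1 : |μ.1 s - ν.1 s| ≤ ∑ s, |μ.1 s - ν.1 s| :=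
      Finset.single_le_sum (f := fun s => |μ.1 s - ν.1 s|) (fun i _ => abs_nonneg _)
        (Finset.mem_univ s)
    have h2 : |μ.1 s - ν.1 s| ≤ 1 := abs_le.2
      ⟨by linarith [hμ0 s, hν1 s], by linarith [hμ1 s, (hν0 s).le]⟩
    rw [← sq_abs]
    nlinarith [abs_nonneg (μ.1 s - ν.1 s)]
  · rw [Divergence.eval, fDivergence, if_pos fun s h => absurd h (hν0 s).ne']
    refine ENNReal.ofReal_le_ofReal ?_
    have h1 : (∑ s, (μ.1 s / ν.1 s - 1) ^ 2 * ν.1 s) / 9 ≤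
        ∑ s, (μ.1 s / ν.1 s * Real.log (μ.1 s / ν.1 s) - (μ.1 s / ν.1 s - 1)) * ν.1 s := by
      rw [Finset.sum_div]
      refine Finset.sum_le_sum fun s _ => ?_
      rw [mul_div_right_comm]
      refine mul_le_mul_of_nonneg_right (sub_one_sq_le_mul_log
        (div_nonneg (hμ0 s) (hν0 s).le) ?_) (hν0 s).le
      rw [div_le_iff₀ (hν0 s)]
      linarith [hμ1 s, hν s]
    have h2 : ∑ s, (μ.1 s / ν.1 s * Real.log (μ.1 s / ν.1 s) - (μ.1 s / ν.1 s - 1)) * ν.1 s =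
        ∑ s, μ.1 s / ν.1 s * Real.log (μ.1 s / ν.1 s) * ν.1 s := by
      simp_rw [sub_mul, one_mul, hmul, Finset.sum_sub_distrib, μ.2.2, ν.2.2, sub_self, sub_zero]
    linarith
  · rw [Divergence.eval, fDivergence, if_pos fun s h => absurd h (hν0 s).ne']
    refine ENNReal.ofReal_le_ofReal ?_
    linarith [sq_nonneg (μ.1 s - ν.1 s)]

end Divergences

section Bellman

variable {S A : Type} [Fintype S] {d H : ℕ} {φ : FeatureMap S A d}

theorem linearTransition_nonneg (φ : FeatureMap S A d) (μ : Fin H → Fin d → stdSimplex ℝ S)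
    (h : Fin H) (s : S) (a : A) (s' : S) : 0 ≤ LinearRRMDP.linearTransition φ μ h s a s' :=
  Finset.sum_nonneg fun i _ => mul_nonneg (φ.feat_nonneg s a i) ((μ h i).2.1 s')

theorem sum_feat_mul_simplex (φ : FeatureMap S A d) (μ : Fin d → stdSimplex ℝ S) (s : S) (a : A) :
    ∑ s', ∑ i, φ.feat s a i * (μ i).1 s' = 1 := by
  rw [Finset.sum_comm]
  simp_rw [← Finset.mul_sum, (μ _).2.2, mul_one, φ.feat_sum]

theorem sum_linearTransition (φ : FeatureMap S A d) (μ : Fin H → Fin d → stdSimplex ℝ S)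
    (h : Fin H) (s : S) (a : A) : ∑ s', LinearRRMDP.linearTransition φ μ h s a s' = 1 :=
  sum_feat_mul_simplex φ (μ h) s a

theorem sum_linearTransition_mul (φ : FeatureMap S A d) (μ : Fin H → Fin d → stdSimplex ℝ S)
    (h : Fin H) (s : S) (a : A) (V : S → ℝ) :
    ∑ s', LinearRRMDP.linearTransition φ μ h s a s' * V s' =
      ∑ i, φ.feat s a i * ∑ s', (μ h i).1 s' * V s' := by
  simp_rw [LinearRRMDP.linearTransition, Finset.sum_mul, Finset.mul_sum]
  rw [Finset.sum_comm]
  simp_rw [mul_assoc]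

/-- Choosing the nominal factors in the infimum: the robust value is at most the nominal value. -/
theorem LinearRRMDP.value_le_nominal [Fintype A] (M : LinearRRMDP φ H) (lam : ℝ) (D : Divergence)
    (π : Policy S A H) (h : ℕ) (s : S) :
    M.value lam D π h s ≤ expectedSum π (linearTransition φ M.μ₀)
      (fun t s a => ENNReal.ofReal (M.reward t s a)) h s := by
  refine (iInf_le _ M.μ₀).trans (le_of_eq ?_)
  simp [Divergence.eval_self]

end Bellman

/-! ### The law of the dataset -/

section Chain

variable {X : Type*} [Fintype X]

/-- The index before `h`; the index `0` is its own predecessor. -/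
def prevStep {n : ℕ} (h : Fin n) : Fin n := ⟨h.1 - 1, lt_of_le_of_lt (Nat.sub_le _ _) h.2⟩

/-- The weight of a path of the Markov chain with kernels `q h x y`. The kernel of the step `0` is
meant not to depend on its source `x`. -/
def chainWeight {n : ℕ} (q : Fin n → X → X → ℝ) (τ : Fin n → X) : ℝ :=
  ∏ h, q h (τ (prevStep h)) (τ h)

/-- Splitting off the last step of a chain; `x` gives the state before the last step. -/
theorem exists_sum_chainWeight_succ [Nonempty X] {n : ℕ} (q : Fin (n + 1) → X → X → ℝ)
    (h0 : ∀ x x' y, q 0 x y = q 0 x' y) :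
    ∃ x : (Fin n → X) → X, ∀ G : (Fin (n + 1) → X) → ℝ,
      ∑ τ, chainWeight q τ * G τ =
        ∑ τ, chainWeight (fun h => q h.castSucc) τ *
          ∑ y, q (Fin.last n) (x τ) y * G (Fin.snoc (α := fun _ => X) τ y) := by
  obtain ⟨x, hx⟩ : ∃ x : (Fin n → X) → X, ∀ τ y, q (Fin.last n)
      (Fin.snoc (α := fun _ => X) τ y (prevStep (Fin.last n))) y = q (Fin.last n) (x τ) y := by
    cases n with
    | zero => exact ⟨fun _ => Classical.arbitrary X, fun τ y => h0 _ _ _⟩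
    | succ n =>
      refine ⟨fun τ => τ (Fin.last n), fun τ y => ?_⟩
      have : prevStep (Fin.last (n + 1)) = (Fin.last n).castSucc := by
        ext; simp [prevStep]
      rw [this, Fin.snoc_castSucc]
  refine ⟨x, fun G => ?_⟩
  rw [← (Fin.snocEquiv fun _ => X).sum_comp, Fintype.sum_prod_type, Finset.sum_comm]
  refine Finset.sum_congr rfl fun τ _ => ?_
  rw [Finset.mul_sum]
  refine Finset.sum_congr rfl fun y _ => ?_
  simp only [Fin.snocEquiv, Equiv.coe_fn_mk]
  rw [← mul_assoc, chainWeight, Fin.prod_univ_castSucc, Fin.snoc_last, hx]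
  congr 2
  refine Finset.prod_congr rfl fun h _ => ?_
  have : prevStep h.castSucc = (prevStep h).castSucc := rfl
  rw [this, Fin.snoc_castSucc, Fin.snoc_castSucc]

theorem sum_chainWeight [Nonempty X] {n : ℕ} (q : Fin n → X → X → ℝ)
    (h0 : ∀ h : Fin n, h.1 = 0 → ∀ x x' y, q h x y = q h x' y)
    (h1 : ∀ h x, ∑ y, q h x y = 1) : ∑ τ, chainWeight q τ = 1 := by
  induction n with
  | zero => simp [chainWeight]
  | succ n ih =>
    obtain ⟨x, hx⟩ := exists_sum_chainWeight_succ q (h0 0 rfl)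
    simpa [h1, ih (fun h => q h.castSucc) (fun h hh => h0 _ hh) fun h => h1 _] using
      hx fun _ => 1

/-- An expectation at the step `t` is bounded by the bound for its conditional expectations given the
previous step: the later steps sum to one. -/
theorem sum_chainWeight_mul_le [Nonempty X] {n : ℕ} (q : Fin n → X → X → ℝ)
    (h0 : ∀ h : Fin n, h.1 = 0 → ∀ x x' y, q h x y = q h x' y)
    (h1 : ∀ h x, ∑ y, q h x y = 1) (hq : ∀ h x y, 0 ≤ q h x y) (f : X → ℝ) {B : ℝ} (t : Fin n)
    (hB : ∀ x, ∑ y, q t x y * f y ≤ B) : ∑ τ, chainWeight q τ * f (τ t) ≤ B := by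
  induction n with
  | zero => exact t.elim0
  | succ n ih =>
    obtain ⟨x, hx⟩ := exists_sum_chainWeight_succ q (h0 0 rfl)
    rw [hx fun τ => f (τ t)]
    induction t using Fin.lastCases with
    | last =>
      simp only [Fin.snoc_last]
      calc _ ≤ ∑ τ, chainWeight (fun h => q h.castSucc) τ * B := Finset.sum_le_sum fun τ _ =>
            mul_le_mul_of_nonneg_left (hB _) (Finset.prod_nonneg fun h _ => hq _ _ _)
        _ = B := by
            rw [← Finset.sum_mul, sum_chainWeight (fun h => q h.castSucc) (fun h hh => h0 _ hh)
              fun h => h1 _, one_mul]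
    | cast t =>
      simp only [Fin.snoc_castSucc, ← Finset.sum_mul, h1, one_mul]
      exact ih (fun h => q h.castSucc) (fun h hh => h0 _ hh) (fun h => h1 _) (fun h => hq _) t hB

end Chain

section PathWeight

variable {S A : Type} [Fintype S] [Fintype A] {H : ℕ}

/-- The kernels of the state-action chain; its `chainWeight` is `pathWeight` by definition. -/
def stateActionKernel (ρ : stdSimplex ℝ S) (π : Policy S A H) (P : Transition S A H) (h : Fin H)
    (x y : S × A) : ℝ :=
  (if h.1 = 0 then ρ.1 y.1 else P (prevStep h) x.1 x.2 y.1) * (π h y.1).1 y.2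

theorem stateActionKernel_nonneg (ρ : stdSimplex ℝ S) (π : Policy S A H) {P : Transition S A H}
    (hP : ∀ h s a s', 0 ≤ P h s a s') (h : Fin H) (x y : S × A) :
    0 ≤ stateActionKernel ρ π P h x y := by
  refine mul_nonneg ?_ ((π h y.1).2.1 y.2)
  split_ifs
  · exact ρ.2.1 _
  · exact hP _ _ _ _

theorem pathWeight_nonneg (ρ : stdSimplex ℝ S) (π : Policy S A H) {P : Transition S A H}
    (hP : ∀ h s a s', 0 ≤ P h s a s') (τ : Fin H → S × A) : 0 ≤ pathWeight ρ π P τ :=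
  Finset.prod_nonneg fun h _ => stateActionKernel_nonneg ρ π hP h _ _

theorem sum_stateActionKernel_mul_le (ρ : stdSimplex ℝ S) (π : Policy S A H) {P : Transition S A H}
    (hP : ∀ h s a s', 0 ≤ P h s a s') (hP1 : ∀ h s a, ∑ s', P h s a s' = 1) (t : Fin H)
    (f : S × A → ℝ) {B : ℝ} (hB : ∀ s, ∑ a, (π t s).1 a * f (s, a) ≤ B) (x : S × A) :
    ∑ y, stateActionKernel ρ π P t x y * f y ≤ B := by
  obtain ⟨p, hp0, hp1, hp⟩ : ∃ p : S → ℝ, (∀ s, 0 ≤ p s) ∧ ∑ s, p s = 1 ∧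
      ∀ y, stateActionKernel ρ π P t x y = p y.1 * (π t y.1).1 y.2 := by
    refine ⟨fun s => if t.1 = 0 then ρ.1 s else P (prevStep t) x.1 x.2 s, fun s => ?_, ?_,
      fun y => rfl⟩
    · beta_reduce
      split_ifs
      exacts [ρ.2.1 _, hP _ _ _ _]
    · split_ifs
      exacts [ρ.2.2, hP1 _ _ _]
  rw [Fintype.sum_prod_type]
  calc _ = ∑ s, p s * ∑ a, (π t s).1 a * f (s, a) := by simp_rw [hp, Finset.mul_sum, mul_assoc]
    _ ≤ ∑ s, p s * B := Finset.sum_le_sum fun s _ => mul_le_mul_of_nonneg_left (hB s) (hp0 s)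
    _ = B := by rw [← Finset.sum_mul, hp1, one_mul]

theorem sum_stateActionKernel (ρ : stdSimplex ℝ S) (π : Policy S A H) {P : Transition S A H}
    (hP1 : ∀ h s a, ∑ s', P h s a s' = 1) (t : Fin H) (x : S × A) :
    ∑ y, stateActionKernel ρ π P t x y = 1 := by
  simp_rw [Fintype.sum_prod_type, stateActionKernel, ← Finset.mul_sum, (π t _).2.2, mul_one]
  split_ifs
  exacts [ρ.2.2, hP1 _ _ _]

theorem stateActionKernel_zero (ρ : stdSimplex ℝ S) (π : Policy S A H) (P : Transition S A H)
    (h : Fin H) (hh : h.1 = 0) (x x' y : S × A) :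
    stateActionKernel ρ π P h x y = stateActionKernel ρ π P h x' y := by
  simp [stateActionKernel, hh]

theorem sum_pathWeight [Nonempty (S × A)] (ρ : stdSimplex ℝ S) (π : Policy S A H)
    {P : Transition S A H} (hP1 : ∀ h s a, ∑ s', P h s a s' = 1) : ∑ τ, pathWeight ρ π P τ = 1 :=
  sum_chainWeight _ (stateActionKernel_zero ρ π P) (sum_stateActionKernel ρ π hP1)

theorem sum_pathWeight_mul_le [Nonempty (S × A)] (ρ : stdSimplex ℝ S) (π : Policy S A H)
    {P : Transition S A H} (hP : ∀ h s a s', 0 ≤ P h s a s')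
    (hP1 : ∀ h s a, ∑ s', P h s a s' = 1) (t : Fin H) (f : S × A → ℝ) {B : ℝ}
    (hB : ∀ s, ∑ a, (π t s).1 a * f (s, a) ≤ B) :
    ∑ τ, pathWeight ρ π P τ * f (τ t) ≤ B :=
  sum_chainWeight_mul_le _ (stateActionKernel_zero ρ π P) (sum_stateActionKernel ρ π hP1)
    (stateActionKernel_nonneg ρ π hP) f t (sum_stateActionKernel_mul_le ρ π hP hP1 t f hB)

end PathWeight

section Ratio

variable {S A : Type} [Fintype S] {d H : ℕ} {φ : FeatureMap S A d}

namespace LinearRRMDP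

/-- The likelihood ratio of the rewards at one step under `M'` and `M`. -/
noncomputable def stepRatio (M M' : LinearRRMDP φ H) (h : Fin H) (p : (S × A) × ℝ) : ℝ≥0∞ :=
  gaussianRatio (M.reward h p.1.1 p.1.2) (M'.reward h p.1.1 p.1.2 - M.reward h p.1.1 p.1.2) p.2

/-- The likelihood ratio of one trajectory under `M'` and `M`, which have the same nominal
factors. -/
noncomputable def trajectoryRatio (M M' : LinearRRMDP φ H) (y : Fin H → (S × A) × ℝ) : ℝ≥0∞ :=
  ∏ h, M.stepRatio M' h (y h)

/-- The likelihood ratio of the dataset under `M'` and `M`, which have the same nominal factors. -/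
noncomputable def datasetRatio (M M' : LinearRRMDP φ H) {K : ℕ} (x : Dataset S A H K) : ℝ≥0∞ :=
  ∏ k, M.trajectoryRatio M' (x k)

end LinearRRMDP

end Ratio

section Laws

variable {S A : Type} [Fintype S] [Fintype A] [MeasurableSpace S] [MeasurableSpace A]
  {d H : ℕ} {φ : FeatureMap S A d}

theorem lintegral_dirac_prod {α β : Type*} [MeasurableSpace α] [MeasurableSpace β] (x : α)
    (ν : Measure β) [SFinite ν] {f : α × β → ℝ≥0∞} (hf : Measurable f) :
    ∫⁻ p, f p ∂(Measure.dirac x).prod ν = ∫⁻ r, f (x, r) ∂ν := by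
  rw [Measure.dirac_prod, lintegral_map hf measurable_prodMk_left]

theorem dirac_prod_withDensity {α β : Type*} [MeasurableSpace α] [MeasurableSpace β] (x : α)
    (ν : Measure β) [SFinite ν] {f : α × β → ℝ≥0∞} (hf : Measurable f)
    [SFinite (ν.withDensity fun r => f (x, r))] :
    (Measure.dirac x).prod (ν.withDensity fun r => f (x, r)) =
      ((Measure.dirac x).prod ν).withDensity f := by
  ext s hs
  rw [withDensity_apply _ hs, Measure.dirac_prod, Measure.dirac_prod,
    setLIntegral_map hs hf measurable_prodMk_left, Measure.map_apply measurable_prodMk_left hs,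
    withDensity_apply _ (measurable_prodMk_left hs)]

namespace LinearRRMDP

theorem lintegral_trajectoryLaw_prod (M : LinearRRMDP φ H) (ρ : stdSimplex ℝ S) (π : Policy S A H)
    (F : Fin H → (S × A) × ℝ → ℝ≥0∞) (hF : ∀ h, Measurable (F h)) :
    ∫⁻ y, ∏ h, F h (y h) ∂M.trajectoryLaw ρ π =
      ∑ τ, ENNReal.ofReal (pathWeight ρ π (linearTransition φ M.μ₀) τ) *
        ∏ h, ∫⁻ r, F h (τ h, r) ∂gaussianReal (M.reward h (τ h).1 (τ h).2) 1 := by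
  rw [trajectoryLaw, lintegral_finsetSum_measure]
  refine Finset.sum_congr rfl fun τ _ => ?_
  rw [lintegral_smul_measure, smul_eq_mul, lintegral_pi_prod _ _ hF]
  simp_rw [lintegral_dirac_prod _ _ (hF _)]

section Measurable

variable [DiscreteMeasurableSpace S] [DiscreteMeasurableSpace A]

theorem measurable_stepRatio (M M' : LinearRRMDP φ H) (h : Fin H) :
    Measurable (M.stepRatio M' h) := by
  have h1 : Measurable fun p : (S × A) × ℝ => M.reward h p.1.1 p.1.2 :=
    (measurable_of_finite fun q : S × A => M.reward h q.1 q.2).comp measurable_fst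
  have h2 : Measurable fun p : (S × A) × ℝ => M'.reward h p.1.1 p.1.2 :=
    (measurable_of_finite fun q : S × A => M'.reward h q.1 q.2).comp measurable_fst
  unfold stepRatio gaussianRatio
  fun_prop

theorem measurable_trajectoryRatio (M M' : LinearRRMDP φ H) :
    Measurable (M.trajectoryRatio M') :=
  Finset.measurable_fun_prod _ fun h _ => (M.measurable_stepRatio M' h).comp (measurable_pi_apply h)

theorem measurable_datasetRatio (M M' : LinearRRMDP φ H) (K : ℕ) :
    Measurable (M.datasetRatio M' (K := K)) :=
  Finset.measurable_fun_prod _ fun k _ =>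
    (M.measurable_trajectoryRatio M').comp (measurable_pi_apply k)

theorem trajectoryLaw_eq_withDensity (M M' : LinearRRMDP φ H) (hμ : M'.μ₀ = M.μ₀)
    (ρ : stdSimplex ℝ S) (π : Policy S A H) :
    M'.trajectoryLaw ρ π = (M.trajectoryLaw ρ π).withDensity (M.trajectoryRatio M') := by
  rw [trajectoryLaw, trajectoryLaw, ← Measure.sum_fintype, ← Measure.sum_fintype,
    withDensity_sum, hμ]
  congr 1
  ext1 τ
  rw [withDensity_smul_measure]
  congr 1
  refine pi_withDensity _ _ (M.stepRatio M') (M.measurable_stepRatio M') fun h => ?_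
  have hg : gaussianReal (M'.reward h (τ h).1 (τ h).2) 1 =
      (gaussianReal (M.reward h (τ h).1 (τ h).2) 1).withDensity
        fun r => M.stepRatio M' h (τ h, r) := by
    have := gaussianReal_add_eq_withDensity (M.reward h (τ h).1 (τ h).2)
      (M'.reward h (τ h).1 (τ h).2 - M.reward h (τ h).1 (τ h).2)
    rwa [add_sub_cancel] at this
  have : SFinite ((gaussianReal (M.reward h (τ h).1 (τ h).2) 1).withDensity
        fun r => M.stepRatio M' h (τ h, r)) := hg ▸ inferInstance
  rw [hg, dirac_prod_withDensity _ _ (M.measurable_stepRatio M' h)]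

end Measurable

section Probability

variable [Nonempty (S × A)]

instance isProbabilityMeasure_trajectoryLaw (M : LinearRRMDP φ H) (ρ : stdSimplex ℝ S)
    (π : Policy S A H) : IsProbabilityMeasure (M.trajectoryLaw ρ π) := by
  constructor
  have := M.lintegral_trajectoryLaw_prod ρ π (fun _ _ => 1) fun _ => measurable_const
  simp only [Finset.prod_const_one, lintegral_one, measure_univ, mul_one] at this
  rw [this, ← ENNReal.ofReal_sum_of_nonneg fun τ _ =>
    pathWeight_nonneg ρ π (linearTransition_nonneg φ M.μ₀) τ,
    sum_pathWeight _ _ (sum_linearTransition φ M.μ₀), ENNReal.ofReal_one]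

instance isProbabilityMeasure_datasetLaw (M : LinearRRMDP φ H) (ρ : stdSimplex ℝ S)
    (π : Policy S A H) (K : ℕ) : IsProbabilityMeasure (M.datasetLaw ρ π K) := by
  unfold datasetLaw; infer_instance

theorem lintegral_datasetLaw_prod (M : LinearRRMDP φ H) (ρ : stdSimplex ℝ S) (π : Policy S A H)
    (K : ℕ) (F : (Fin H → (S × A) × ℝ) → ℝ≥0∞) (hF : Measurable F) :
    ∫⁻ x, ∏ k, F (x k) ∂M.datasetLaw ρ π K = (∫⁻ y, F y ∂M.trajectoryLaw ρ π) ^ K := by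
  rw [datasetLaw, lintegral_pi_prod _ (fun _ => F) fun _ => hF, Finset.prod_const,
    Finset.card_univ, Fintype.card_fin]

variable [DiscreteMeasurableSpace S] [DiscreteMeasurableSpace A]

/-- An expectation of a function of the state-action pair at a single step. -/
theorem lintegral_trajectoryLaw_step_le (M : LinearRRMDP φ H) (ρ : stdSimplex ℝ S)
    (π : Policy S A H) (t : Fin H) (f : S × A → ℝ) (hf : ∀ y, 0 ≤ f y) {B : ℝ}
    (hB : ∀ s, ∑ a, (π t s).1 a * f (s, a) ≤ B) :
    ∫⁻ y, ENNReal.ofReal (f (y t).1) ∂M.trajectoryLaw ρ π ≤ ENNReal.ofReal B := by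
  have hP := linearTransition_nonneg φ M.μ₀
  have := M.lintegral_trajectoryLaw_prod ρ π
    (fun h p => if h = t then ENNReal.ofReal (f p.1) else 1) fun h => by
      split_ifs
      · exact (measurable_of_finite fun p => ENNReal.ofReal (f p)).comp measurable_fst
      · exact measurable_const
  have hite : ∀ (τ : Fin H → S × A) h, ∫⁻ _, (if h = t then ENNReal.ofReal (f (τ h)) else 1)
      ∂gaussianReal (M.reward h (τ h).1 (τ h).2) 1 =
        if h = t then ENNReal.ofReal (f (τ h)) else 1 := fun τ h => by
    rw [lintegral_const, measure_univ, mul_one]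
  simp only [hite, Finset.prod_ite_eq', Finset.mem_univ, if_true] at this
  rw [this]
  simp_rw [← ENNReal.ofReal_mul (pathWeight_nonneg ρ π hP _)]
  rw [← ENNReal.ofReal_sum_of_nonneg fun τ _ => mul_nonneg (pathWeight_nonneg ρ π hP τ) (hf _)]
  exact ENNReal.ofReal_le_ofReal (sum_pathWeight_mul_le ρ π hP
    (sum_linearTransition φ M.μ₀) t f hB)

theorem datasetLaw_eq_withDensity (M M' : LinearRRMDP φ H) (hμ : M'.μ₀ = M.μ₀)
    (ρ : stdSimplex ℝ S) (π : Policy S A H) (K : ℕ) :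
    M'.datasetLaw ρ π K = (M.datasetLaw ρ π K).withDensity (M.datasetRatio M') :=
  pi_withDensity _ _ (fun _ => M.trajectoryRatio M')
    (fun _ => M.measurable_trajectoryRatio M') fun _ => M.trajectoryLaw_eq_withDensity M' hμ ρ π

theorem lintegral_datasetRatio (M M' : LinearRRMDP φ H) (hμ : M'.μ₀ = M.μ₀)
    (ρ : stdSimplex ℝ S) (π : Policy S A H) (K : ℕ) :
    ∫⁻ x, M.datasetRatio M' x ∂M.datasetLaw ρ π K = 1 := by
  rw [← setLIntegral_univ, ← withDensity_apply _ MeasurableSet.univ,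
    ← M.datasetLaw_eq_withDensity M' hμ, measure_univ]

/-- The second moment of the likelihood ratio when the rewards of `M` and `M'` differ at the single
step `t`. -/
theorem lintegral_datasetRatio_sq_le (M M' : LinearRRMDP φ H)
    (ρ : stdSimplex ℝ S) (π : Policy S A H) (K : ℕ) (t : Fin H)
    (ht : ∀ h ≠ t, ∀ s a, M'.reward h s a = M.reward h s a) {B : ℝ}
    (hB : ∀ s, ∑ a, (π t s).1 a *
      Real.exp ((M'.reward t s a - M.reward t s a) ^ 2) ≤ B) :
    ∫⁻ x, M.datasetRatio M' x ^ 2 ∂M.datasetLaw ρ π K ≤ ENNReal.ofReal B ^ K := by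
  simp_rw [datasetRatio, ← Finset.prod_pow]
  rw [M.lintegral_datasetLaw_prod ρ π K (fun y => M.trajectoryRatio M' y ^ 2)
    ((M.measurable_trajectoryRatio M').pow_const 2)]
  gcongr
  refine le_trans (le_of_eq ?_) (M.lintegral_trajectoryLaw_step_le ρ π t
    (fun p => Real.exp ((M'.reward t p.1 p.2 - M.reward t p.1 p.2) ^ 2))
    (fun _ => Real.exp_nonneg _) hB)
  have hone : ∀ (τ : Fin H → S × A), ∏ h, ∫⁻ r, M.stepRatio M' h (τ h, r) ^ 2
      ∂gaussianReal (M.reward h (τ h).1 (τ h).2) 1 =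
      ∏ h, ∫⁻ _, (if h = t then ENNReal.ofReal
        (Real.exp ((M'.reward t (τ h).1 (τ h).2 - M.reward t (τ h).1 (τ h).2) ^ 2)) else 1)
        ∂gaussianReal (M.reward h (τ h).1 (τ h).2) 1 := fun τ => by
    refine Finset.prod_congr rfl fun h _ => ?_
    simp only [stepRatio]
    rw [lintegral_gaussianRatio_sq, lintegral_const, measure_univ, mul_one]
    split_ifs with hh
    · rw [hh]
    · rw [ht h hh, sub_self]; simp
  simp_rw [trajectoryRatio, ← Finset.prod_pow]
  rw [M.lintegral_trajectoryLaw_prod ρ π (fun h p => M.stepRatio M' h p ^ 2)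
    fun h => (M.measurable_stepRatio M' h).pow_const 2]
  simp_rw [hone]
  rw [← M.lintegral_trajectoryLaw_prod ρ π (fun h p => if h = t then ENNReal.ofReal
    (Real.exp ((M'.reward t p.1.1 p.1.2 - M.reward t p.1.1 p.1.2) ^ 2)) else 1)]
  · simp
  · intro h
    split_ifs
    · exact (measurable_of_finite fun p : S × A => ENNReal.ofReal
        (Real.exp ((M'.reward t p.1 p.2 - M.reward t p.1 p.2) ^ 2))).comp measurable_fst
    · exact measurable_const

end Probability

end LinearRRMDP

end Laws

/-! ### Gram matrices and action counts -/

section Gram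

/-- The quadratic form of `Λ⁻¹` at `v` is at most any `B` with `⟨v, x⟩² ≤ B ⟨x, Λ x⟩`; the bound follows by
taking `x = Λ⁻¹ v`. -/
theorem _root_.Matrix.PosDef.dotProduct_inv_mulVec_le {ι : Type*} [Fintype ι] [DecidableEq ι]
    {Λ : Matrix ι ι ℝ} (hΛ : Λ.PosDef) (v : ι → ℝ) {B : ℝ} (hB : 0 ≤ B)
    (h : ∀ x, (v ⬝ᵥ x) ^ 2 ≤ B * (x ⬝ᵥ Λ.mulVec x)) : v ⬝ᵥ Λ⁻¹.mulVec v ≤ B := by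
  have hdet : IsUnit Λ.det := (Matrix.isUnit_iff_isUnit_det _).1 hΛ.isUnit
  have hx := h (Λ⁻¹.mulVec v)
  rw [Matrix.mulVec_mulVec, Matrix.mul_nonsing_inv _ hdet, Matrix.one_mulVec,
    dotProduct_comm (Λ⁻¹.mulVec v) v] at hx
  nlinarith

variable {S A : Type} {d H K : ℕ}

theorem gram_posDef (φ : FeatureMap S A d) (x : Dataset S A H K) (h : Fin H) :
    (gram φ x h).PosDef := by
  refine Matrix.PosDef.one.add_posSemidef (Matrix.posSemidef_sum _ fun k _ => ?_)
  simpa using Matrix.posSemidef_vecMulVec_self_star (φ.feat (x k h).1.1 (x k h).1.2)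

theorem dotProduct_gram_mulVec (φ : FeatureMap S A d) (x : Dataset S A H K) (h : Fin H)
    (v : Fin d → ℝ) : v ⬝ᵥ (gram φ x h).mulVec v =
      v ⬝ᵥ v + ∑ k, (φ.feat (x k h).1.1 (x k h).1.2 ⬝ᵥ v) ^ 2 := by
  rw [gram, Matrix.add_mulVec, Matrix.one_mulVec, dotProduct_add, Matrix.sum_mulVec,
    dotProduct_sum]
  congr 1
  refine Finset.sum_congr rfl fun k _ => ?_
  rw [Matrix.vecMulVec_mulVec, dotProduct_smul, dotProduct_comm v]
  simp [sq]

/-- As the features are convex weights, the uncertainty is controlled by the diagonal of the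
inverse Gram matrix. -/
theorem featureUncertainty_le {φ : FeatureMap S A d} {x : Dataset S A H K} {h : Fin H} {B : ℝ}
    (hB : 0 ≤ B) (hx : ∀ i (v : Fin d → ℝ), v i ^ 2 ≤ B * (v ⬝ᵥ (gram φ x h).mulVec v))
    (s : S) (a : A) : featureUncertainty φ x h s a ≤ Real.sqrt B := by
  calc featureUncertainty φ x h s a ≤ ∑ i, φ.feat s a i * Real.sqrt B := by
        refine Finset.sum_le_sum fun i _ => ?_
        have h0 := φ.feat_nonneg s a i
        rw [← Real.sqrt_sq h0, ← Real.sqrt_mul (sq_nonneg _), Real.sqrt_sq h0]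
        refine Real.sqrt_le_sqrt ((gram_posDef φ x h).dotProduct_inv_mulVec_le _
          (mul_nonneg (sq_nonneg _) hB) fun v => ?_)
        rw [single_dotProduct, mul_pow, mul_assoc]
        exact mul_le_mul_of_nonneg_left (hx i v) (sq_nonneg _)
    _ = Real.sqrt B := by rw [← Finset.sum_mul, φ.feat_sum, one_mul]

/-- Of an admissible kernel the bound only uses that it is a transition kernel. -/
theorem uncertainty_le [Fintype S] [Fintype A] {φ : FeatureMap S A d} (M : LinearRRMDP φ H)
    (lam : ℝ) (D : Divergence) (π : Policy S A H) (s : S) {x : Dataset S A H K} {B : ℝ}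
    (hB : 0 ≤ B) (hx : ∀ h i (v : Fin d → ℝ), v i ^ 2 ≤ B * (v ⬝ᵥ (gram φ x h).mulVec v)) :
    uncertainty M lam D π s x ≤ ENNReal.ofReal (H * Real.sqrt B) := by
  refine iSup₂_le fun P hP => ?_
  refine expectedSum_le_of_cost_le π P _ (fun h s a s' => ?_) (fun h s a => ?_)
    (fun h s a => Finset.sum_nonneg fun i _ => Real.sqrt_nonneg _)
    (fun h s a => featureUncertainty_le hB (hx h) s a) s
  · obtain ⟨μ, -, hμ⟩ := hP h s a
    rw [hμ]
    exact Finset.sum_nonneg fun i _ => mul_nonneg (φ.feat_nonneg s a i) ((μ i).2.1 s')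
  · obtain ⟨μ, -, hμ⟩ := hP h s a
    simp_rw [hμ]
    exact sum_feat_mul_simplex φ μ s a

end Gram

section Counts

variable {S A : Type} [DecidableEq A] {H K : ℕ}

/-- The number of trajectories that take the action `b` at the step `t`. -/
def actionCount (x : Dataset S A H K) (t : Fin H) (b : A) : ℕ :=
  (Finset.univ.filter fun k => (x k t).1.2 = b).card

/-- A multiplicative Chernoff bound for the lower tail of the number of uses of an action. -/
theorem LinearRRMDP.datasetLaw_actionCount_lt_le [Fintype S] [Fintype A] [MeasurableSpace S]
    [MeasurableSpace A] [DiscreteMeasurableSpace S] [DiscreteMeasurableSpace A]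
    [Nonempty (S × A)] {d : ℕ} {φ : FeatureMap S A d} (M : LinearRRMDP φ H) (ρ : stdSimplex ℝ S)
    (π : Policy S A H) (t : Fin H) (b : A) {p : ℝ} (hp0 : 0 ≤ p)
    (hp : ∀ s, p ≤ (π t s).1 b) :
    M.datasetLaw ρ π K {x | (actionCount x t b : ℝ) < K * p / 2} ≤
      ENNReal.ofReal (Real.exp (-(K * p / 8))) := by
  -- Markov's inequality for `exp (-N)`, where `N` is the number of uses of `b`.
  set f : S × A → ℝ := fun y => if y.2 = b then Real.exp (-1) else 1 with hf
  have hf0 : ∀ y, 0 ≤ f y := fun y => by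
    simp only [hf]; split_ifs <;> positivity
  have he : Real.exp (-1) ≤ 3 / 8 := by linarith [Real.exp_neg_one_lt_d9]
  have hmeas : Measurable fun y : Fin H → (S × A) × ℝ => ENNReal.ofReal (f (y t).1) :=
    ((measurable_of_finite fun q => ENNReal.ofReal (f q)).comp measurable_fst).comp
      (measurable_pi_apply t)
  have hstep : ∫⁻ y, ENNReal.ofReal (f (y t).1) ∂M.trajectoryLaw ρ π ≤
      ENNReal.ofReal (Real.exp (-(5 / 8 * p))) := by
    refine M.lintegral_trajectoryLaw_step_le ρ π t f hf0 fun s => ?_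
    have hsum : ∑ a, (π t s).1 a * f (s, a) = 1 - (π t s).1 b * (1 - Real.exp (-1)) := by
      have : ∀ a, (π t s).1 a * f (s, a) =
          (π t s).1 a - if a = b then (π t s).1 a * (1 - Real.exp (-1)) else 0 := fun a => by
        simp only [hf]; split_ifs <;> ring
      simp_rw [this]
      rw [Finset.sum_sub_distrib, (π t s).2.2, Finset.sum_ite_eq' Finset.univ b,
        if_pos (Finset.mem_univ b)]
    rw [hsum]
    have := Real.add_one_le_exp (-(5 / 8 * p))
    nlinarith [hp s, (π t s).2.1 b]
  have hprod : ∀ x : Dataset S A H K, ∏ k, ENNReal.ofReal (f (x k t).1) =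
      ENNReal.ofReal (Real.exp (-(actionCount x t b : ℝ))) := fun x => by
    rw [← ENNReal.ofReal_prod_of_nonneg fun k _ => hf0 _]
    simp only [hf]
    rw [Finset.prod_ite, Finset.prod_const, Finset.prod_const_one, mul_one, ← Real.exp_nat_mul,
      actionCount]
    congr 2
    ring
  have hint : ∫⁻ x, ENNReal.ofReal (Real.exp (-(actionCount x t b : ℝ))) ∂M.datasetLaw ρ π K ≤
      ENNReal.ofReal (Real.exp (-(5 / 8 * (K * p)))) := by
    simp_rw [← hprod]
    rw [M.lintegral_datasetLaw_prod ρ π K _ hmeas]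
    calc _ ≤ ENNReal.ofReal (Real.exp (-(5 / 8 * p))) ^ K := by gcongr
      _ = _ := by
        rw [← ENNReal.ofReal_pow (Real.exp_nonneg _), ← Real.exp_nat_mul]
        congr 2
        ring
  have hm : Measurable fun x : Dataset S A H K =>
      ENNReal.ofReal (Real.exp (-(actionCount x t b : ℝ))) := by
    simp_rw [← hprod]
    exact Finset.measurable_fun_prod _ fun k _ => hmeas.comp (measurable_pi_apply k)
  have hmarkov := (mul_meas_ge_le_lintegral (μ := M.datasetLaw ρ π K) hm
    (ENNReal.ofReal (Real.exp (-(K * p / 2))))).trans hint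
  have hsub : M.datasetLaw ρ π K {x | (actionCount x t b : ℝ) < K * p / 2} ≤
      M.datasetLaw ρ π K {x | ENNReal.ofReal (Real.exp (-(K * p / 2))) ≤
        ENNReal.ofReal (Real.exp (-(actionCount x t b : ℝ)))} := by
    refine measure_mono fun x hx => ENNReal.ofReal_le_ofReal (Real.exp_le_exp.2 ?_)
    have : (actionCount x t b : ℝ) < K * p / 2 := hx
    linarith
  refine hsub.trans ?_
  have hpos : ENNReal.ofReal (Real.exp (-(K * p / 2))) ≠ 0 := by
    simpa using Real.exp_pos _
  refine (ENNReal.mul_le_mul_iff_right hpos ENNReal.ofReal_ne_top).1 (hmarkov.trans ?_)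
  rw [← ENNReal.ofReal_mul (Real.exp_nonneg _), ← Real.exp_add]
  refine ENNReal.ofReal_le_ofReal (Real.exp_le_exp.2 ?_)
  linarith

end Counts

/-! ### The hard instances -/

section OpenLoop

variable {S A : Type} [Fintype S] {d H : ℕ} {φ : FeatureMap S A d}

namespace LinearRRMDP

/-- The value carried by the factor `j` at the step `h`: its reward parameter plus the nominal
expectation of the continuation `V`. -/
noncomputable def factorValue (M : LinearRRMDP φ H) (h : Fin H) (V : S → ℝ) (j : Fin d) : ℝ :=
  M.θ h j + ∑ s', (M.μ₀ h j).1 s' * V s'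

theorem reward_add_nominal (M : LinearRRMDP φ H) (h : Fin H) (V : S → ℝ) (s : S) (a : A) :
    M.reward h s a + ∑ s', linearTransition φ M.μ₀ h s a s' * V s' =
      ∑ j, φ.feat s a j * M.factorValue h V j := by
  rw [sum_linearTransition_mul, reward, ← Finset.sum_add_distrib]
  exact Finset.sum_congr rfl fun j _ => (mul_add _ _ _).symm

/-- The value, under the nominal transitions, of playing the fixed action `b h` at every step
`h`. -/
noncomputable def openLoopValue (M : LinearRRMDP φ H) (b : Fin H → A) (h : ℕ) (s : S) : ℝ :=
  if hh : h < H then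
    ∑ j, φ.feat s (b ⟨h, hh⟩) j * M.factorValue ⟨h, hh⟩ (openLoopValue M b (h + 1)) j
  else 0
termination_by H - h

theorem openLoopValue_of_lt (M : LinearRRMDP φ H) (b : Fin H → A) (h : Fin H) (s : S) :
    M.openLoopValue b h s =
      ∑ j, φ.feat s (b h) j * M.factorValue h (M.openLoopValue b (h + 1)) j := by
  rw [openLoopValue, dif_pos h.2]

theorem openLoopValue_of_ge (M : LinearRRMDP φ H) (b : Fin H → A) {h : ℕ} (hh : H ≤ h) (s : S) :
    M.openLoopValue b h s = 0 := by
  rw [openLoopValue, dif_neg hh.not_gt]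

end LinearRRMDP

end OpenLoop

section Hypercube

/-- An enumeration of the vertices of the hypercube. -/
noncomputable def hypercube (n : ℕ) : Fin (2 ^ n) ≃ (Fin n → Bool) :=
  (Fintype.equivFinOfCardEq (by simp)).symm

/-- The `i`-th coordinate of a vertex, as a real number. -/
noncomputable def bit {n : ℕ} (a : Fin (2 ^ n)) (i : Fin n) : ℝ := if hypercube n a i then 1 else 0

/-- The strength of the actions, which is halved in the state `1`. -/
noncomputable def strength (s : Fin 2) : ℝ := if s = 0 then 1 else 1 / 2

theorem bit_nonneg {n : ℕ} (a : Fin (2 ^ n)) (i : Fin n) : 0 ≤ bit a i := by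
  unfold bit; split_ifs <;> norm_num

theorem bit_le_one {n : ℕ} (a : Fin (2 ^ n)) (i : Fin n) : bit a i ≤ 1 := by
  unfold bit; split_ifs <;> norm_num

theorem half_le_strength (s : Fin 2) : 1 / 2 ≤ strength s := by
  unfold strength; split_ifs <;> norm_num

theorem strength_le_one (s : Fin 2) : strength s ≤ 1 := by
  unfold strength; split_ifs <;> norm_num

/-- The weight of the `i`-th learnable factor. -/
noncomputable def coordWeight {n : ℕ} (s : Fin 2) (a : Fin (2 ^ n)) (i : Fin n) : ℝ :=
  strength s / n * bit a i

theorem coordWeight_nonneg {n : ℕ} (s : Fin 2) (a : Fin (2 ^ n)) (i : Fin n) :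
    0 ≤ coordWeight s a i :=
  mul_nonneg (div_nonneg (by linarith [half_le_strength s]) n.cast_nonneg) (bit_nonneg a i)

theorem coordWeight_le {n : ℕ} (s : Fin 2) (a : Fin (2 ^ n)) (i : Fin n) :
    coordWeight s a i ≤ 1 / n := by
  have hn : (0 : ℝ) ≤ n := n.cast_nonneg
  have h1 : strength s / n ≤ 1 / n := by gcongr; exact strength_le_one s
  exact (mul_le_of_le_one_right (div_nonneg (by linarith [half_le_strength s]) hn)
    (bit_le_one a i)).trans h1

theorem sum_coordWeight_le {n : ℕ} (s : Fin 2) (a : Fin (2 ^ n)) : ∑ i, coordWeight s a i ≤ 1 := by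
  refine (Finset.sum_le_sum fun i _ => coordWeight_le s a i).trans ?_
  rw [Finset.sum_const, Finset.card_univ, Fintype.card_fin, nsmul_eq_mul, mul_one_div]
  exact div_self_le_one _

/-- The features of the hard instances: the factor `0` is a base factor, and the bit `i` of an
action moves weight from it to the factor `i + 1`. -/
noncomputable def hypercubeFeatures (n : ℕ) : FeatureMap (Fin 2) (Fin (2 ^ n)) (n + 1) where
  feat s a := Fin.cons (1 - ∑ i, coordWeight s a i) (coordWeight s a)
  feat_nonneg s a j := by
    refine Fin.cases ?_ (fun i => ?_) j
    · simpa using sum_coordWeight_le s a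
    · simpa using coordWeight_nonneg s a i
  feat_sum s a := by simp [Fin.sum_univ_succ]

theorem sum_hypercubeFeatures_mul {n : ℕ} (s : Fin 2) (a : Fin (2 ^ n)) (g : Fin (n + 1) → ℝ) :
    ∑ j, (hypercubeFeatures n).feat s a j * g j =
      g 0 + ∑ i, coordWeight s a i * (g i.succ - g 0) := by
  simp only [hypercubeFeatures, Fin.sum_univ_succ, Fin.cons_zero, Fin.cons_succ, mul_sub,
    Finset.sum_sub_distrib, ← Finset.sum_mul]
  ring

/-- The law on two states with mass `p` at the state `0`. -/
noncomputable def twoPoint (p : ℝ) (h0 : 0 ≤ p) (h1 : p ≤ 1) : stdSimplex ℝ (Fin 2) :=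
  ⟨![p, 1 - p], by
    refine ⟨fun s => ?_, by simp⟩
    fin_cases s
    · simpa using h0
    · simpa using h1⟩

/-- The nominal law of the base factor. -/
noncomputable def baseFactor : stdSimplex ℝ (Fin 2) := twoPoint (1 / 2) (by norm_num) (by norm_num)

/-- The nominal law of the learnable factors. -/
noncomputable def coordFactor : stdSimplex ℝ (Fin 2) := twoPoint (3 / 4) (by norm_num) (by norm_num)

/-- The sign of a hidden bit. -/
noncomputable def bitSign (b : Bool) : ℝ := if b then 1 else -1

theorem abs_bitSign (b : Bool) : |bitSign b| = 1 := by
  cases b <;> simp [bitSign]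

/-- The hard instance with hidden bits `ξ`: at the step `h`, the factor `i + 1` is better or worse
than the base factor by `ε`, according to the bit `ξ h i`. The nominal factors do not depend on
`ξ`. -/
noncomputable def hardInstance {n H : ℕ} (ε : ℝ) (hε0 : 0 ≤ ε) (hε : ε ≤ 1 / 2)
    (ξ : Fin H → Fin n → Bool) : LinearRRMDP (hypercubeFeatures n) H where
  θ h := WithLp.toLp 2 (Fin.cons (1 / 2) fun i => 1 / 2 + bitSign (ξ h i) * ε)
  μ₀ _ := Fin.cons baseFactor fun _ => coordFactor
  θ_norm h := by
    rw [EuclideanSpace.norm_eq]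
    refine Real.sqrt_le_sqrt ?_
    rw [Fin.sum_univ_succ]
    have hi : ∀ i, ‖1 / 2 + bitSign (ξ h i) * ε‖ ^ 2 ≤ 1 := fun i => by
      have : |bitSign (ξ h i) * ε| ≤ 1 / 2 := by
        rw [abs_mul, abs_bitSign, one_mul, abs_of_nonneg hε0]; exact hε
      have h2 := abs_le.1 this
      rw [Real.norm_eq_abs, sq_abs]
      nlinarith
    calc _ ≤ (1 : ℝ) + ∑ i : Fin n, (1 : ℝ) := by
          refine add_le_add ?_ (Finset.sum_le_sum fun i _ => ?_)
          · simp only [Fin.cons_zero]; norm_num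
          · simpa using hi i
      _ = _ := by simp [add_comm]
  reward_mem h s a := by
    rw [sum_hypercubeFeatures_mul]
    have hsum : |∑ i, coordWeight s a i * (bitSign (ξ h i) * ε)| ≤ 1 / 2 := by
      calc _ ≤ ∑ i, |coordWeight s a i * (bitSign (ξ h i) * ε)| := Finset.abs_sum_le_sum_abs _ _
        _ = ∑ i, coordWeight s a i * ε := Finset.sum_congr rfl fun i _ => by
            rw [abs_mul, abs_mul, abs_bitSign, one_mul, abs_of_nonneg hε0,
              abs_of_nonneg (coordWeight_nonneg s a i)]
        _ ≤ 1 * ε := by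
            rw [← Finset.sum_mul]
            exact mul_le_mul_of_nonneg_right (sum_coordWeight_le s a) hε0
        _ ≤ 1 / 2 := by linarith
    have h2 := abs_le.1 hsum
    simp only [Fin.cons_zero, Fin.cons_succ, add_sub_cancel_left]
    constructor <;> linarith [h2.1, h2.2]

section Instance

variable {n H : ℕ} {ε : ℝ} {hε0 : 0 ≤ ε} {hε : ε ≤ 1 / 2}

theorem hardInstance_reward (ξ : Fin H → Fin n → Bool) (h : Fin H) (s : Fin 2)
    (a : Fin (2 ^ n)) : (hardInstance ε hε0 hε ξ).reward h s a =
      1 / 2 + ∑ i, coordWeight s a i * (bitSign (ξ h i) * ε) := by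
  rw [LinearRRMDP.reward, sum_hypercubeFeatures_mul]
  simp [hardInstance]

theorem quarter_le_hardInstance_μ₀ (ξ : Fin H → Fin n → Bool) (h : Fin H) (j : Fin (n + 1))
    (s : Fin 2) : 1 / 4 ≤ ((hardInstance ε hε0 hε ξ).μ₀ h j).1 s := by
  refine Fin.cases ?_ (fun i => ?_) j <;> fin_cases s <;>
    norm_num [hardInstance, baseFactor, coordFactor, twoPoint]

/-- The gain of the factor `i + 1` over the base factor. -/
theorem hardInstance_factorValue_sub (ξ : Fin H → Fin n → Bool) (h : Fin H) (V : Fin 2 → ℝ)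
    (i : Fin n) : (hardInstance ε hε0 hε ξ).factorValue h V i.succ -
      (hardInstance ε hε0 hε ξ).factorValue h V 0 =
        bitSign (ξ h i) * ε + (V 0 - V 1) / 4 := by
  simp only [LinearRRMDP.factorValue, hardInstance, baseFactor, coordFactor, twoPoint,
    Fin.sum_univ_two, Fin.cons_zero, Fin.cons_succ]
  simp
  ring

/-- The greedy actions of the instance `ξ`. -/
noncomputable def greedyAction (ξ : Fin H → Fin n → Bool) (h : Fin H) : Fin (2 ^ n) :=
  (hypercube n).symm (ξ h)

theorem bit_greedyAction (ξ : Fin H → Fin n → Bool) (h : Fin H) (i : Fin n) :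
    bit (greedyAction ξ h) i = if ξ h i then 1 else 0 := by
  simp [bit, greedyAction]

/-- The greedy nominal value varies over the states by at most `ε`, so that continuation values
never outweigh the rewards. -/
theorem openLoopValue_spread (hn : 0 < n) (ξ : Fin H → Fin n → Bool) : ∀ h ≤ H,
    0 ≤ (hardInstance ε hε0 hε ξ).openLoopValue (greedyAction ξ) h 0 -
        (hardInstance ε hε0 hε ξ).openLoopValue (greedyAction ξ) h 1 ∧
    (hardInstance ε hε0 hε ξ).openLoopValue (greedyAction ξ) h 0 -
        (hardInstance ε hε0 hε ξ).openLoopValue (greedyAction ξ) h 1 ≤ ε := by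
  have hn' : (0 : ℝ) < n := by exact_mod_cast hn
  refine backward_induction ?_ fun h ih => ?_
  · simp [LinearRRMDP.openLoopValue_of_ge, hε0]
  rw [LinearRRMDP.openLoopValue_of_lt, LinearRRMDP.openLoopValue_of_lt,
    sum_hypercubeFeatures_mul, sum_hypercubeFeatures_mul, add_sub_add_left_eq_sub,
    ← Finset.sum_sub_distrib]
  simp_rw [hardInstance_factorValue_sub, ← sub_mul]
  set Δ := (hardInstance ε hε0 hε ξ).openLoopValue (greedyAction ξ) (h + 1) 0 -
        (hardInstance ε hε0 hε ξ).openLoopValue (greedyAction ξ) (h + 1) 1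
  have hterm : ∀ i, 0 ≤ (coordWeight 0 (greedyAction ξ h) i -
      coordWeight 1 (greedyAction ξ h) i) * (bitSign (ξ h i) * ε + Δ / 4) ∧
      (coordWeight 0 (greedyAction ξ h) i -
      coordWeight 1 (greedyAction ξ h) i) * (bitSign (ξ h i) * ε + Δ / 4) ≤ ε / n := fun i => by
    simp only [coordWeight, bit_greedyAction, strength]
    cases ξ h i
    · simp only [Bool.false_eq_true, if_false, mul_zero, sub_zero, zero_mul]
      exact ⟨le_rfl, by positivity⟩
    · -- A set bit gains between `ε` and `5 ε / 4`, with weight larger by `1 / (2 n)` in state `0`.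
      simp only [bitSign, if_true, mul_one, one_mul, one_ne_zero, if_false]
      have e : ((1 : ℝ) / n - 1 / 2 / n) * (ε + Δ / 4) = (ε + Δ / 4) / 2 / n := by
        field_simp; ring
      rw [e]
      refine ⟨div_nonneg (by linarith [ih.1]) hn'.le, ?_⟩
      gcongr
      linarith [ih.2]
  refine ⟨Finset.sum_nonneg fun i _ => (hterm i).1,
    (Finset.sum_le_sum fun i _ => (hterm i).2).trans (le_of_eq ?_)⟩
  rw [Finset.sum_const, Finset.card_univ, Fintype.card_fin, nsmul_eq_mul]
  field_simp

/-- Whether the bit `i` of the action `a` differs from `b`. -/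
noncomputable def disagree (b : Bool) (a : Fin (2 ^ n)) (i : Fin n) : ℝ :=
  if hypercube n a i = b then 0 else 1

theorem disagree_nonneg (b : Bool) (a : Fin (2 ^ n)) (i : Fin n) : 0 ≤ disagree b a i := by
  unfold disagree; split_ifs <;> norm_num

/-- Every wrong bit of an action costs at least `ε / (4 n)`. -/
theorem factorValue_le_openLoopValue_sub (hn : 0 < n) (ξ : Fin H → Fin n → Bool) (h : Fin H)
    (s : Fin 2) (a : Fin (2 ^ n)) :
    ∑ j, (hypercubeFeatures n).feat s a j * (hardInstance ε hε0 hε ξ).factorValue h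
        ((hardInstance ε hε0 hε ξ).openLoopValue (greedyAction ξ) (h + 1)) j ≤
      (hardInstance ε hε0 hε ξ).openLoopValue (greedyAction ξ) h s -
        ∑ i, ε / (4 * n) * disagree (ξ h i) a i := by
  have hn' : (0 : ℝ) < n := by exact_mod_cast hn
  have hΔ := openLoopValue_spread (ε := ε) (hε0 := hε0) (hε := hε) hn ξ (h + 1) h.2
  rw [LinearRRMDP.openLoopValue_of_lt, sum_hypercubeFeatures_mul, sum_hypercubeFeatures_mul,
    add_sub_assoc, ← Finset.sum_sub_distrib]
  simp_rw [hardInstance_factorValue_sub]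
  set Δ := (hardInstance ε hε0 hε ξ).openLoopValue (greedyAction ξ) (h + 1) 0 -
        (hardInstance ε hε0 hε ξ).openLoopValue (greedyAction ξ) (h + 1) 1
  refine add_le_add_right (Finset.sum_le_sum fun i _ => ?_) _
  have hs := half_le_strength s
  have e4 : ε / (4 * n) = ε / 4 / n := by field_simp
  simp only [coordWeight, bit_greedyAction]
  simp only [bit, disagree, e4]
  cases ξ h i <;> cases hypercube n a i <;>
    simp only [bitSign, if_true, Bool.false_eq_true, Bool.true_eq_false, if_false, mul_one,
      mul_zero, zero_mul, sub_zero, one_mul, zero_sub, le_refl]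
  · rw [div_mul_eq_mul_div, ← neg_div]
    gcongr
    nlinarith
  · rw [div_mul_eq_mul_div, ← sub_div]
    refine div_nonneg ?_ hn'.le
    nlinarith

/-- The probability, under the law `p` on actions, that the bit `i` differs from `b`. -/
noncomputable def errorProb (p : stdSimplex ℝ (Fin (2 ^ n))) (i : Fin n) (b : Bool) : ℝ :=
  ∑ a, p.1 a * disagree b a i

theorem errorProb_nonneg (p : stdSimplex ℝ (Fin (2 ^ n))) (i : Fin n) (b : Bool) :
    0 ≤ errorProb p i b :=
  Finset.sum_nonneg fun a _ => mul_nonneg (p.2.1 a) (disagree_nonneg b a i)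

theorem errorProb_add_not (p : stdSimplex ℝ (Fin (2 ^ n))) (i : Fin n) (b : Bool) :
    errorProb p i b + errorProb p i (!b) = 1 := by
  rw [errorProb, errorProb, ← Finset.sum_add_distrib, ← p.2.2]
  refine Finset.sum_congr rfl fun a _ => ?_
  rw [← mul_add]
  cases b <;> cases h : hypercube n a i <;> simp [disagree, h]

/-- The regret that the policy `π` incurs at the step `h` in the state `s` through wrong bits. -/
noncomputable def bitRegret (ε : ℝ) (ξ : Fin H → Fin n → Bool) (π : Policy (Fin 2) (Fin (2 ^ n)) H)
    (h : Fin H) (s : Fin 2) : ℝ :=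
  ∑ i, ε / (4 * n) * errorProb (π h s) i (ξ h i)

theorem bitRegret_nonneg (hε0 : 0 ≤ ε) (ξ : Fin H → Fin n → Bool)
    (π : Policy (Fin 2) (Fin (2 ^ n)) H) (h : Fin H) (s : Fin 2) : 0 ≤ bitRegret ε ξ π h s :=
  Finset.sum_nonneg fun i _ => mul_nonneg (by positivity) (errorProb_nonneg _ _ _)

/-- A lower bound for the regret from the step `h` on: as every transition reaches the state `0`
with probability at least `1 / 4`, it suffices to count the wrong bits in that state. -/
noncomputable def tailRegret (ε : ℝ) (ξ : Fin H → Fin n → Bool)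
    (π : Policy (Fin 2) (Fin (2 ^ n)) H) (h : ℕ) : ℝ :=
  ∑ t : Fin H, if h ≤ t.1 then bitRegret ε ξ π t 0 / 4 else 0

theorem tailRegret_of_ge (ξ : Fin H → Fin n → Bool) (π : Policy (Fin 2) (Fin (2 ^ n)) H) {h : ℕ}
    (hh : H ≤ h) : tailRegret ε ξ π h = 0 :=
  Finset.sum_eq_zero fun t _ => if_neg (by have := t.2; omega)

theorem tailRegret_of_lt (ξ : Fin H → Fin n → Bool) (π : Policy (Fin 2) (Fin (2 ^ n)) H)
    (h : Fin H) : tailRegret ε ξ π h = bitRegret ε ξ π h 0 / 4 + tailRegret ε ξ π (h + 1) := by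
  have : ∀ t : Fin H, (if h.1 ≤ t.1 then bitRegret ε ξ π t 0 / 4 else 0) =
      (if t = h then bitRegret ε ξ π t 0 / 4 else 0) +
        if h.1 + 1 ≤ t.1 then bitRegret ε ξ π t 0 / 4 else 0 := fun t => by
    rcases lt_trichotomy t h with hlt | rfl | hlt
    · have : t.1 < h.1 := hlt
      rw [if_neg this.not_ge, if_neg hlt.ne, if_neg (by omega), add_zero]
    · simp
    · have : h.1 < t.1 := hlt
      rw [if_pos this.le, if_neg hlt.ne', if_pos (by omega), zero_add]
  rw [tailRegret, Finset.sum_congr rfl fun t _ => this t, Finset.sum_add_distrib,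
    Finset.sum_ite_eq' Finset.univ h, if_pos (Finset.mem_univ h), tailRegret]

/-- The regret of `π` from the step `h` on, started in the state `s`. -/
noncomputable def totalRegret (ε : ℝ) (ξ : Fin H → Fin n → Bool)
    (π : Policy (Fin 2) (Fin (2 ^ n)) H) (h : ℕ) (s : Fin 2) : ℝ :=
  if hh : h < H then bitRegret ε ξ π ⟨h, hh⟩ s + tailRegret ε ξ π (h + 1) else 0

theorem tailRegret_le_sum_totalRegret (hε0 : 0 ≤ ε) (ξ : Fin H → Fin n → Bool)
    (π : Policy (Fin 2) (Fin (2 ^ n)) H) (h : ℕ) (p : Fin 2 → ℝ) (hp0 : 1 / 4 ≤ p 0)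
    (hp1 : 0 ≤ p 1) (hp : ∑ s, p s = 1) :
    tailRegret ε ξ π h ≤ ∑ s, p s * totalRegret ε ξ π h s := by
  by_cases hh : h < H
  · simp only [totalRegret, dif_pos hh, mul_add, Finset.sum_add_distrib, ← Finset.sum_mul, hp,
      one_mul]
    rw [tailRegret_of_lt ξ π ⟨h, hh⟩, Fin.sum_univ_two]
    have h0 := bitRegret_nonneg hε0 ξ π ⟨h, hh⟩ 0
    have h1 := bitRegret_nonneg hε0 ξ π ⟨h, hh⟩ 1
    nlinarith [mul_nonneg hp1 h1]
  · simp [totalRegret, hh, tailRegret_of_ge ξ π (not_lt.1 hh)]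

/-- The nominal value of `π` falls short of the greedy one by the regret, so its robust value does
too. -/
theorem value_hardInstance_le (hn : 0 < n) (ξ : Fin H → Fin n → Bool) (lam : ℝ) (D : Divergence)
    (π : Policy (Fin 2) (Fin (2 ^ n)) H) (s : Fin 2) :
    0 ≤ (hardInstance ε hε0 hε ξ).openLoopValue (greedyAction ξ) 0 s - totalRegret ε ξ π 0 s ∧
    (hardInstance ε hε0 hε ξ).value lam D π 0 s ≤ ENNReal.ofReal
      ((hardInstance ε hε0 hε ξ).openLoopValue (greedyAction ξ) 0 s - totalRegret ε ξ π 0 s) := by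
  set M := hardInstance ε hε0 hε ξ with hM
  have hP := linearTransition_nonneg (hypercubeFeatures n) M.μ₀
  have hP1 := sum_linearTransition (hypercubeFeatures n) M.μ₀
  have hsup := expectedSum_le_of_supersolution π (LinearRRMDP.linearTransition _ M.μ₀) M.reward
    (fun h s => M.openLoopValue (greedyAction ξ) h s - totalRegret ε ξ π h s) hP
    (fun h s a => (M.reward_mem h s a).1)
    (fun s => by simp [M.openLoopValue_of_ge, totalRegret]) (fun h s => ?_) 0 (Nat.zero_le _) s
  · exact ⟨hsup.1, (M.value_le_nominal lam D π 0 s).trans hsup.2⟩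
  have hterm : ∀ a, M.reward h s a + ∑ s', LinearRRMDP.linearTransition _ M.μ₀ h s a s' *
      (M.openLoopValue (greedyAction ξ) (h + 1) s' - totalRegret ε ξ π (h + 1) s') ≤
      M.openLoopValue (greedyAction ξ) h s - ∑ i, ε / (4 * n) * disagree (ξ h i) a i -
        tailRegret ε ξ π (h + 1) := fun a => by
    have h1 := tailRegret_le_sum_totalRegret hε0 ξ π (h + 1)
      (LinearRRMDP.linearTransition _ M.μ₀ h s a) ?_ (hP h s a 1) (hP1 h s a)
    · have h2 := factorValue_le_openLoopValue_sub (hε0 := hε0) (hε := hε) hn ξ h s a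
      rw [← hM, ← M.reward_add_nominal] at h2
      simp_rw [mul_sub, Finset.sum_sub_distrib]
      rw [← add_sub_assoc]
      exact sub_le_sub h2 h1
    · calc (1 / 4 : ℝ) = ∑ j, (hypercubeFeatures n).feat s a j * (1 / 4) := by
            rw [← Finset.sum_mul, (hypercubeFeatures n).feat_sum, one_mul]
        _ ≤ _ := Finset.sum_le_sum fun j _ => mul_le_mul_of_nonneg_left
            (quarter_le_hardInstance_μ₀ ξ h j 0) ((hypercubeFeatures n).feat_nonneg s a j)
  refine (Finset.sum_le_sum fun a _ => mul_le_mul_of_nonneg_left (hterm a)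
    ((π h s).2.1 a)).trans (le_of_eq ?_)
  have hreg : bitRegret ε ξ π h s =
      ∑ a, (π h s).1 a * ∑ i, ε / (4 * n) * disagree (ξ h i) a i := by
    simp_rw [bitRegret, errorProb, Finset.mul_sum]
    rw [Finset.sum_comm]
    exact Finset.sum_congr rfl fun a _ => Finset.sum_congr rfl fun i _ => by ring
  simp_rw [mul_sub, Finset.sum_sub_distrib, ← Finset.sum_mul, (π h s).2.2, one_mul]
  rw [← hreg, totalRegret, dif_pos h.2]
  ring

/-- Robustness costs the greedy policy at most `3 ε² / lam` per step: moving mass `u` between the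
states gains at most `ε |u|` and is penalized by at least `lam u² / 9`. -/
theorem le_optValue_hardInstance (hn : 0 < n) (ξ : Fin H → Fin n → Bool) {lam : ℝ}
    (hlam : 0 < lam) (D : Divergence) (s : Fin 2) :
    ENNReal.ofReal ((hardInstance ε hε0 hε ξ).openLoopValue (greedyAction ξ) 0 s -
      H * (3 * ε ^ 2 / lam)) ≤ (hardInstance ε hε0 hε ξ).optValue lam D 0 s := by
  set M := hardInstance ε hε0 hε ξ with hM
  let π : Policy (Fin 2) (Fin (2 ^ n)) H := fun h _ =>
    ⟨Pi.single (greedyAction ξ h) 1, single_mem_stdSimplex ℝ _⟩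
  refine le_trans (le_iInf fun μ => ?_) (le_iSup (fun π => M.value lam D π 0 s) π)
  have hfeat := (hypercubeFeatures n).feat_nonneg
  have hsub := ofReal_le_expectedSum_of_subsolution π
    (LinearRRMDP.linearTransition (hypercubeFeatures n) μ)
    (fun t s a => ENNReal.ofReal (M.reward t s a) + ENNReal.ofReal lam *
      ∑ i, ENNReal.ofReal ((hypercubeFeatures n).feat s a i) * D.eval (μ t i) (M.μ₀ t i))
    (fun t s a => M.reward t s a + lam * ∑ i, (hypercubeFeatures n).feat s a i *
      (((μ t i).1 0 - (M.μ₀ t i).1 0) ^ 2 / 9))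
    (fun h s => M.openLoopValue (greedyAction ξ) h s - ((H : ℝ) - h) * (3 * ε ^ 2 / lam))
    (linearTransition_nonneg _ μ) (fun t s a => ?_)
    (fun s => by simp [M.openLoopValue_of_ge]) (fun h s => ?_) 0 (Nat.zero_le _) s
  · simpa using hsub
  · refine ENNReal.ofReal_add_le.trans (add_le_add le_rfl ?_)
    rw [ENNReal.ofReal_mul hlam.le]
    gcongr
    refine (ofReal_sum_le _ _).trans (Finset.sum_le_sum fun i _ => ?_)
    rw [ENNReal.ofReal_mul (hfeat s a i)]
    gcongr
    exact D.sq_le_eval _ _ (quarter_le_hardInstance_μ₀ ξ t i) 0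
  · have hspread := openLoopValue_spread (hε0 := hε0) (hε := hε) hn ξ (h + 1) h.2
    rw [← hM] at hspread
    set a := greedyAction ξ h with ha
    set V := M.openLoopValue (greedyAction ξ) (h + 1) with hV
    have hsum : ∀ f : Fin (2 ^ n) → ℝ, ∑ a', (π h s).1 a' * f a' = f a := fun f => by
      simp only [π]
      rw [Finset.sum_eq_single a (fun b _ hb => by rw [Pi.single_eq_of_ne hb, zero_mul])
        (fun hne => absurd (Finset.mem_univ a) hne), Pi.single_eq_same, one_mul]
    rw [hsum]
    have hopen : M.openLoopValue (greedyAction ξ) h s = M.reward h s a +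
        ∑ j, (hypercubeFeatures n).feat s a j * ∑ s', (M.μ₀ h j).1 s' * V s' := by
      rw [M.openLoopValue_of_lt, ← M.reward_add_nominal, sum_linearTransition_mul]
    have hrob : ∑ s', LinearRRMDP.linearTransition (hypercubeFeatures n) μ h s a s' *
        (V s' - ((H : ℝ) - ((h.1 + 1 : ℕ) : ℝ)) * (3 * ε ^ 2 / lam)) =
        ∑ j, (hypercubeFeatures n).feat s a j * ∑ s', (μ h j).1 s' * V s' -
          ((H : ℝ) - ((h.1 + 1 : ℕ) : ℝ)) * (3 * ε ^ 2 / lam) := by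
      simp_rw [mul_sub, Finset.sum_sub_distrib]
      rw [sum_linearTransition_mul, ← Finset.sum_mul, sum_linearTransition, one_mul]
    have hkey : 0 ≤ ∑ j, (hypercubeFeatures n).feat s a j *
        (lam * (((μ h j).1 0 - (M.μ₀ h j).1 0) ^ 2 / 9) + ∑ s', (μ h j).1 s' * V s' -
          ∑ s', (M.μ₀ h j).1 s' * V s' + 3 * ε ^ 2 / lam) := by
      refine Finset.sum_nonneg fun j _ => mul_nonneg (hfeat s a j) ?_
      have h1 : (μ h j).1 1 = 1 - (μ h j).1 0 := by
        have := (μ h j).2.2; rw [Fin.sum_univ_two] at this; linarith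
      have h2 : (M.μ₀ h j).1 1 = 1 - (M.μ₀ h j).1 0 := by
        have := (M.μ₀ h j).2.2; rw [Fin.sum_univ_two] at this; linarith
      rw [Fin.sum_univ_two, Fin.sum_univ_two, h1, h2]
      set u := (μ h j).1 0 - (M.μ₀ h j).1 0 with hu
      -- Completing the square in `u`.
      have e : lam * (u ^ 2 / 9) + ((μ h j).1 0 * V 0 + (1 - (μ h j).1 0) * V 1) -
          ((M.μ₀ h j).1 0 * V 0 + (1 - (M.μ₀ h j).1 0) * V 1) + 3 * ε ^ 2 / lam =
          ((lam * u / 3 + 3 / 2 * (V 0 - V 1)) ^ 2 +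
            (3 * ε ^ 2 - 9 / 4 * (V 0 - V 1) ^ 2)) / lam := by
        rw [hu]; field_simp; ring
      rw [e]
      have : (V 0 - V 1) ^ 2 ≤ ε ^ 2 := pow_le_pow_left₀ hspread.1 hspread.2 2
      exact div_nonneg (add_nonneg (sq_nonneg _) (by nlinarith [sq_nonneg ε])) hlam.le
    simp only [mul_add, mul_sub, Finset.sum_add_distrib, Finset.sum_sub_distrib,
      ← Finset.sum_mul, (hypercubeFeatures n).feat_sum, one_mul] at hkey
    rw [hrob, hopen, Finset.mul_sum]
    simp_rw [mul_left_comm lam]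
    generalize 3 * ε ^ 2 / lam = ℓ at hkey ⊢
    push_cast
    linarith

end Instance

end Hypercube

/-! ### Exploration and information -/

section Exploration

variable {n H : ℕ}

/-- The action whose bits all vanish (index `0`) and the actions with the single bit `i` (index
`i + 1`). -/
noncomputable def probeAction (n : ℕ) : Fin (n + 1) → Fin (2 ^ n) :=
  Fin.cons ((hypercube n).symm fun _ => false) fun i => (hypercube n).symm fun j => decide (j = i)

theorem bit_probeAction_zero (i : Fin n) : bit (probeAction n 0) i = 0 := by
  simp [bit, probeAction]

theorem bit_probeAction_succ (j i : Fin n) :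
    bit (probeAction n j.succ) i = if i = j then 1 else 0 := by
  simp [bit, probeAction]

/-- The probabilities of the probing actions: `1 / 2` for the zero action and `1 / (2 n)` for each
single bit. -/
noncomputable def probeWeight (n : ℕ) : Fin (n + 1) → ℝ :=
  Fin.cons (1 / 2) fun _ => 1 / (2 * n)

theorem probeWeight_nonneg (j : Fin (n + 1)) : 0 ≤ probeWeight n j := by
  refine Fin.cases ?_ (fun i => ?_) j <;> simp only [probeWeight, Fin.cons_zero, Fin.cons_succ] <;>
    positivity

theorem le_probeWeight (hn : 0 < n) (j : Fin (n + 1)) : 1 / (2 * n) ≤ probeWeight n j := by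
  refine Fin.cases ?_ (fun i => ?_) j
  · have : (1 : ℝ) ≤ n := by exact_mod_cast hn
    simp only [probeWeight, Fin.cons_zero]
    gcongr
    linarith
  · simp [probeWeight]

theorem sum_probeWeight (hn : 0 < n) : ∑ j, probeWeight n j = 1 := by
  have : (n : ℝ) ≠ 0 := by exact_mod_cast hn.ne'
  simp only [probeWeight, Fin.sum_univ_succ, Fin.cons_zero, Fin.cons_succ, Finset.sum_const,
    Finset.card_univ, Fintype.card_fin, nsmul_eq_mul]
  field_simp
  norm_num

/-- The behavior policy, which probes one bit at a time. -/
noncomputable def explorePolicy (hn : 0 < n) (H : ℕ) : Policy (Fin 2) (Fin (2 ^ n)) H := fun _ _ =>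
  ⟨∑ j, probeWeight n j • Pi.single (probeAction n j) 1, (convex_stdSimplex ℝ _).sum_mem
    (fun j _ => probeWeight_nonneg j) (sum_probeWeight hn)
    fun _ _ => single_mem_stdSimplex ℝ _⟩

theorem sum_explorePolicy_mul (hn : 0 < n) (h : Fin H) (s : Fin 2) (f : Fin (2 ^ n) → ℝ) :
    ∑ a, (explorePolicy hn H h s).1 a * f a = ∑ j, probeWeight n j * f (probeAction n j) := by
  simp only [explorePolicy, Finset.sum_apply, Pi.smul_apply, smul_eq_mul, Finset.sum_mul]
  rw [Finset.sum_comm]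
  refine Finset.sum_congr rfl fun j _ => ?_
  rw [Finset.sum_eq_single (probeAction n j)
    (fun b _ hb => by rw [Pi.single_eq_of_ne hb, mul_zero, zero_mul])
    (fun hne => absurd (Finset.mem_univ _) hne), Pi.single_eq_same, mul_one]

theorem le_explorePolicy (hn : 0 < n) (h : Fin H) (s : Fin 2) (j : Fin (n + 1)) :
    1 / (2 * n) ≤ (explorePolicy hn H h s).1 (probeAction n j) := by
  have := sum_explorePolicy_mul hn h s fun a => if a = probeAction n j then 1 else 0
  simp only [mul_ite, mul_one, mul_zero, Finset.sum_ite_eq', Finset.mem_univ, if_true] at this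
  rw [this]
  refine (le_probeWeight hn j).trans ?_
  refine le_trans (by simp) (Finset.single_le_sum (fun i _ => ?_) (Finset.mem_univ j))
  split_ifs
  exacts [probeWeight_nonneg _, le_rfl]

end Exploration

section Information

variable {n H : ℕ} {ε : ℝ} {hε0 : 0 ≤ ε} {hε : ε ≤ 1 / 2}

/-- Flipping the hidden bit `i` of the step `t`. -/
def flipBit (ξ : Fin H → Fin n → Bool) (t : Fin H) (i : Fin n) : Fin H → Fin n → Bool :=
  Function.update ξ t (Function.update (ξ t) i (!ξ t i))

theorem flipBit_same (ξ : Fin H → Fin n → Bool) (t : Fin H) (i : Fin n) :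
    flipBit ξ t i t i = !ξ t i := by simp [flipBit]

theorem flipBit_involutive (t : Fin H) (i : Fin n) :
    Function.Involutive fun ξ : Fin H → Fin n → Bool => flipBit ξ t i := fun ξ => by
  simp [flipBit]

theorem hardInstance_reward_flipBit_sub (ξ : Fin H → Fin n → Bool) (t : Fin H) (i : Fin n)
    (s : Fin 2) (a : Fin (2 ^ n)) :
    ((hardInstance ε hε0 hε (flipBit ξ t i)).reward t s a -
      (hardInstance ε hε0 hε ξ).reward t s a) ^ 2 = 4 * ε ^ 2 * coordWeight s a i ^ 2 := by
  rw [hardInstance_reward, hardInstance_reward, add_sub_add_left_eq_sub,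
    ← Finset.sum_sub_distrib, Finset.sum_eq_single i (fun j _ hj => by simp [flipBit, hj])
      (fun hne => absurd (Finset.mem_univ _) hne), flipBit_same]
  cases ξ t i <;> simp [bitSign] <;> ring

theorem exp_le_one_add_two_mul {x : ℝ} (h0 : 0 ≤ x) (h1 : x ≤ 1) : Real.exp x ≤ 1 + 2 * x := by
  have := Real.abs_exp_sub_one_le (x := x) (by rwa [abs_of_nonneg h0])
  rw [abs_of_nonneg h0] at this
  linarith [(abs_le.1 this).2]

/-- With `ε² ≤ n³ / (16 K)` a dataset of size `K` does not reveal a hidden bit: a bit is probed with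
probability `1 / (2 n)`, and then moves the mean reward by at most `2 ε / n`. -/
theorem lintegral_datasetRatio_flipBit_sq_le (hn : 0 < n) (ρ : stdSimplex ℝ (Fin 2)) {K : ℕ}
    (hK : 16 * (K * ε ^ 2) ≤ n ^ 3) (ξ : Fin H → Fin n → Bool) (t : Fin H) (i : Fin n) :
    ∫⁻ x, (hardInstance ε hε0 hε ξ).datasetRatio (hardInstance ε hε0 hε (flipBit ξ t i)) x ^ 2
      ∂(hardInstance ε hε0 hε ξ).datasetLaw ρ (explorePolicy hn H) K ≤ 2 := by
  have hn' : (1 : ℝ) ≤ n := by exact_mod_cast hn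
  have hnonneg : 0 ≤ 4 * ε ^ 2 / n ^ 3 := by positivity
  refine (LinearRRMDP.lintegral_datasetRatio_sq_le _ _ ρ (explorePolicy hn H) K t
    (B := 1 + 4 * ε ^ 2 / n ^ 3) (fun h hh s a => ?_) fun s => ?_).trans ?_
  · rw [hardInstance_reward, hardInstance_reward]
    simp [flipBit, hh]
  · simp_rw [hardInstance_reward_flipBit_sub]
    rw [sum_explorePolicy_mul]
    have hexp : ∀ j, Real.exp (4 * ε ^ 2 * coordWeight s (probeAction n j) i ^ 2) ≤
        1 + 8 * ε ^ 2 / n ^ 2 * bit (probeAction n j) i := fun j => by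
      have hw0 := coordWeight_nonneg s (probeAction n j) i
      have hw1 : coordWeight s (probeAction n j) i ≤ 1 / n * bit (probeAction n j) i := by
        unfold coordWeight
        have := strength_le_one s
        have := bit_nonneg (probeAction n j) i
        gcongr
      have hb0 := bit_nonneg (probeAction n j) i
      have hb1 := bit_le_one (probeAction n j) i
      have hsq : coordWeight s (probeAction n j) i ^ 2 ≤ 1 / n ^ 2 * bit (probeAction n j) i := by
        calc _ ≤ (1 / n * bit (probeAction n j) i) ^ 2 := by gcongr
          _ = 1 / n ^ 2 * bit (probeAction n j) i ^ 2 := by ring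
          _ ≤ _ := by gcongr; nlinarith
      have hsq1 : coordWeight s (probeAction n j) i ^ 2 ≤ 1 := by
        have : coordWeight s (probeAction n j) i ≤ 1 :=
          (coordWeight_le s _ i).trans ((div_le_one (by linarith)).2 hn')
        nlinarith
      have hε4 : 4 * ε ^ 2 ≤ 1 := by nlinarith
      refine (exp_le_one_add_two_mul (by positivity) ?_).trans ?_
      · nlinarith [sq_nonneg ε, sq_nonneg (coordWeight s (probeAction n j) i)]
      · calc _ ≤ 1 + 2 * (4 * ε ^ 2 * (1 / n ^ 2 * bit (probeAction n j) i)) := by gcongr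
          _ = _ := by ring
    calc _ ≤ ∑ j, probeWeight n j * (1 + 8 * ε ^ 2 / n ^ 2 * bit (probeAction n j) i) :=
          Finset.sum_le_sum fun j _ => mul_le_mul_of_nonneg_left (hexp j) (probeWeight_nonneg j)
      _ = 1 + 8 * ε ^ 2 / n ^ 2 * ∑ j, probeWeight n j * bit (probeAction n j) i := by
          simp_rw [mul_add, Finset.sum_add_distrib, mul_one, sum_probeWeight hn, Finset.mul_sum]
          congr 1
          exact Finset.sum_congr rfl fun j _ => by ring
      _ = 1 + 4 * ε ^ 2 / n ^ 3 := by
          rw [Fin.sum_univ_succ, bit_probeAction_zero]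
          simp only [bit_probeAction_succ, probeWeight, Fin.cons_succ, mul_ite, mul_one, mul_zero,
            Finset.sum_ite_eq, Finset.mem_univ, if_true, zero_add]
          field_simp
          ring
      _ ≤ _ := le_rfl
  · rw [← ENNReal.ofReal_pow (by linarith), ← ENNReal.ofReal_ofNat 2]
    refine ENNReal.ofReal_le_ofReal ?_
    calc (1 + 4 * ε ^ 2 / n ^ 3) ^ K ≤ Real.exp (4 * ε ^ 2 / n ^ 3) ^ K := by
          gcongr; linarith [Real.add_one_le_exp (4 * ε ^ 2 / (n : ℝ) ^ 3)]
      _ = Real.exp (K * (4 * ε ^ 2 / n ^ 3)) := (Real.exp_nat_mul _ _).symm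
      _ ≤ Real.exp (1 / 4) := by
          refine Real.exp_le_exp.2 ?_
          rw [← mul_div_assoc, div_le_iff₀ (by positivity)]
          linarith
      _ ≤ 2 := (exp_le_one_add_two_mul (by norm_num) (by norm_num)).trans (by norm_num)

/-- Averaged over the hidden bits, every learning rule errs on the bit `i` of the step `t` with
probability at least `1 / 4`. -/
theorem card_le_sum_lintegral_errorProb (hn : 0 < n) (ρ : stdSimplex ℝ (Fin 2)) {K : ℕ}
    (hK : 16 * (K * ε ^ 2) ≤ n ^ 3)
    (p : Dataset (Fin 2) (Fin (2 ^ n)) H K → stdSimplex ℝ (Fin (2 ^ n))) (hp : Measurable p)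
    (t : Fin H) (i : Fin n) :
    (Fintype.card (Fin H → Fin n → Bool) : ℝ≥0∞) ≤ 4 * ∑ ξ : Fin H → Fin n → Bool,
      ∫⁻ x, ENNReal.ofReal (errorProb (p x) i (ξ t i))
        ∂(hardInstance ε hε0 hε ξ).datasetLaw ρ (explorePolicy hn H) K := by
  set G : (Fin H → Fin n → Bool) → ℝ≥0∞ := fun ξ =>
    ∫⁻ x, ENNReal.ofReal (errorProb (p x) i (ξ t i))
      ∂(hardInstance ε hε0 hε ξ).datasetLaw ρ (explorePolicy hn H) K with hG
  have hmeas : ∀ b, Measurable fun x => ENNReal.ofReal (errorProb (p x) i b) := fun b => by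
    refine ENNReal.measurable_ofReal.comp (Finset.measurable_fun_sum _ fun a _ => ?_)
    exact ((measurable_pi_apply a).comp (measurable_subtype_coe.comp hp)).mul_const _
  have hpair : ∀ ξ, 1 / 2 ≤ G ξ + G (flipBit ξ t i) := fun ξ => by
    let M := hardInstance ε hε0 hε ξ
    let M' := hardInstance ε hε0 hε (flipBit ξ t i)
    have hμ : M'.μ₀ = M.μ₀ := rfl
    have := half_le_testing_error (M.datasetLaw ρ (explorePolicy hn H) K) (M.datasetRatio M')
      _ _ (M.measurable_datasetRatio M' K) (hmeas (ξ t i)) (hmeas (!ξ t i))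
      (fun x => by rw [← ENNReal.ofReal_add (errorProb_nonneg _ _ _) (errorProb_nonneg _ _ _),
        errorProb_add_not, ENNReal.ofReal_one])
      (M.lintegral_datasetRatio M' hμ ρ (explorePolicy hn H) K)
      (lintegral_datasetRatio_flipBit_sq_le hn ρ hK ξ t i)
    rw [← M.datasetLaw_eq_withDensity M' hμ] at this
    simpa only [hG, flipBit_same] using this
  -- Each instance is paired with the one in which the bit is flipped.
  have hflip : ∑ ξ, G (flipBit ξ t i) = ∑ ξ, G ξ :=
    Equiv.sum_comp (flipBit_involutive t i).toPerm G
  have hsum : (Fintype.card (Fin H → Fin n → Bool) : ℝ≥0∞) * (1 / 2) ≤ 2 * ∑ ξ, G ξ := by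
    calc _ = ∑ ξ : Fin H → Fin n → Bool, (1 / 2 : ℝ≥0∞) := by
          rw [Finset.sum_const, Finset.card_univ, nsmul_eq_mul]
      _ ≤ ∑ ξ, (G ξ + G (flipBit ξ t i)) := Finset.sum_le_sum fun ξ _ => hpair ξ
      _ = _ := by rw [Finset.sum_add_distrib, hflip, two_mul]
  calc (Fintype.card (Fin H → Fin n → Bool) : ℝ≥0∞)
      = 2 * (Fintype.card (Fin H → Fin n → Bool) * (1 / 2)) := by
        rw [mul_left_comm, one_div, ENNReal.mul_inv_cancel (by simp) (by simp), mul_one]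
    _ ≤ 2 * (2 * ∑ ξ, G ξ) := by gcongr
    _ = _ := by rw [← mul_assoc]; norm_num

/-- A single state per step carries the regret: the initial state at the first step and the state `0`
afterwards. -/
theorem sum_errorProb_le_totalRegret (hH : 1 ≤ H) (hε0 : 0 ≤ ε) (ξ : Fin H → Fin n → Bool)
    (π : Policy (Fin 2) (Fin (2 ^ n)) H) (s : Fin 2) :
    ∑ t : Fin H, ∑ i, ε / (16 * n) * errorProb (π t (if t.1 = 0 then s else 0)) i (ξ t i) ≤
      totalRegret ε ξ π 0 s := by
  have hb := bitRegret_nonneg hε0 ξ π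
  have hsum : ∀ t s', ∑ i, ε / (16 * n) * errorProb (π t s') i (ξ t i) =
      bitRegret ε ξ π t s' / 4 := fun t s' => by
    rw [bitRegret, Finset.sum_div]
    exact Finset.sum_congr rfl fun i _ => by ring
  simp_rw [hsum]
  have hterm : ∀ t : Fin H, bitRegret ε ξ π t (if t.1 = 0 then s else 0) / 4 ≤
      (if t = ⟨0, hH⟩ then bitRegret ε ξ π t s else 0) +
        if 0 + 1 ≤ t.1 then bitRegret ε ξ π t 0 / 4 else 0 := fun t => by
    by_cases ht : t.1 = 0
    · have ht' : t = ⟨0, hH⟩ := Fin.ext ht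
      rw [if_pos ht, if_pos ht', if_neg (by omega), add_zero]
      linarith [hb t s]
    · rw [if_neg ht, if_neg (fun h => ht (congrArg Fin.val h)), if_pos (by omega), zero_add]
  refine (Finset.sum_le_sum fun t _ => hterm t).trans (le_of_eq ?_)
  rw [Finset.sum_add_distrib, Finset.sum_ite_eq' Finset.univ, if_pos (Finset.mem_univ _),
    totalRegret, dif_pos (Nat.lt_of_lt_of_le Nat.zero_lt_one hH), tailRegret]

theorem ofReal_errorProb_le_subOpt (hn : 0 < n) (hH : 1 ≤ H) (ξ : Fin H → Fin n → Bool) {lam : ℝ}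
    (hlam : 0 < lam) (D : Divergence) (π : Policy (Fin 2) (Fin (2 ^ n)) H) (s : Fin 2) :
    ∑ t : Fin H, ∑ i, ENNReal.ofReal (ε / (16 * n)) *
        ENNReal.ofReal (errorProb (π t (if t.1 = 0 then s else 0)) i (ξ t i)) ≤
      (hardInstance ε hε0 hε ξ).subOpt lam D π s + ENNReal.ofReal (H * (3 * ε ^ 2 / lam)) := by
  have hval := value_hardInstance_le (hε0 := hε0) (hε := hε) hn ξ lam D π s
  have hopt := le_optValue_hardInstance (hε0 := hε0) (hε := hε) hn ξ hlam D s
  set W := (hardInstance ε hε0 hε ξ).openLoopValue (greedyAction ξ) 0 s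
  set R := totalRegret ε ξ π 0 s with hR
  set ℓ := H * (3 * ε ^ 2 / lam)
  have hsub : ENNReal.ofReal (R - ℓ) ≤ (hardInstance ε hε0 hε ξ).subOpt lam D π s := by
    calc ENNReal.ofReal (R - ℓ) = ENNReal.ofReal (W - ℓ) - ENNReal.ofReal (W - R) := by
          rw [← ENNReal.ofReal_sub _ hval.1]; congr 1; ring
      _ ≤ _ := tsub_le_tsub hopt hval.2
  have hc : 0 ≤ ε / (16 * n) := by positivity
  calc _ = ENNReal.ofReal (∑ t : Fin H, ∑ i, ε / (16 * n) *
        errorProb (π t (if t.1 = 0 then s else 0)) i (ξ t i)) := by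
        rw [ENNReal.ofReal_sum_of_nonneg fun t _ => Finset.sum_nonneg fun i _ =>
          mul_nonneg hc (errorProb_nonneg _ _ _)]
        refine Finset.sum_congr rfl fun t _ => ?_
        rw [ENNReal.ofReal_sum_of_nonneg fun i _ => mul_nonneg hc (errorProb_nonneg _ _ _)]
        exact Finset.sum_congr rfl fun i _ => (ENNReal.ofReal_mul hc).symm
    _ ≤ ENNReal.ofReal ((R - ℓ) + ℓ) := by
        rw [sub_add_cancel]
        exact ENNReal.ofReal_le_ofReal (sum_errorProb_le_totalRegret hH hε0 ξ π s)
    _ ≤ _ := ENNReal.ofReal_add_le.trans (by gcongr)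

/-- Assouad's lemma for the hard instances. -/
theorem le_minimaxSubOpt_add (hn : 0 < n) (hH : 1 ≤ H) (ρ : stdSimplex ℝ (Fin 2)) {K : ℕ}
    (hK : 16 * (K * ε ^ 2) ≤ n ^ 3) {lam : ℝ} (hlam : 0 < lam) (D : Divergence) (s : Fin 2) :
    ENNReal.ofReal (H * ε / 64) ≤
      minimaxSubOpt (Set.range (hardInstance (n := n) (H := H) ε hε0 hε)) ρ (explorePolicy hn H)
        K lam D s + ENNReal.ofReal (H * (3 * ε ^ 2 / lam)) := by
  rw [minimaxSubOpt, ENNReal.iInf_add]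
  refine le_iInf fun πhat => ?_
  rw [ENNReal.iInf_add]
  refine le_iInf fun hπ => ?_
  rw [iSup_range]
  set N : ℝ≥0∞ := ((Fintype.card (Fin H → Fin n → Bool) : ℕ) : ℝ≥0∞) with hN
  set ℓ := ENNReal.ofReal (H * (3 * ε ^ 2 / lam))
  set c := ENNReal.ofReal (ε / (16 * n)) with hc
  set R := ⨆ ξ : Fin H → Fin n → Bool,
    ∫⁻ x, (hardInstance ε hε0 hε ξ).subOpt lam D (πhat x) s
      ∂(hardInstance ε hε0 hε ξ).datasetLaw ρ (explorePolicy hn H) K with hR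
  let v : Fin H → Fin 2 := fun t => if t.1 = 0 then s else 0
  have hmeas : ∀ t, Measurable fun x => πhat x t (v t) := fun t =>
    (measurable_pi_apply (v t)).comp ((measurable_pi_apply t).comp hπ)
  have hmeas' : ∀ t i b, Measurable fun x => ENNReal.ofReal (errorProb (πhat x t (v t)) i b) :=
    fun t i b => by
      refine ENNReal.measurable_ofReal.comp (Finset.measurable_fun_sum _ fun a _ => ?_)
      exact ((measurable_pi_apply a).comp (measurable_subtype_coe.comp (hmeas t))).mul_const _
  have hξ : ∀ ξ : Fin H → Fin n → Bool, ∑ t, ∑ i, c * ∫⁻ x,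
      ENNReal.ofReal (errorProb (πhat x t (v t)) i (ξ t i))
        ∂(hardInstance ε hε0 hε ξ).datasetLaw ρ (explorePolicy hn H) K ≤ R + ℓ := fun ξ => by
    calc _ = ∫⁻ x, ∑ t, ∑ i, c * ENNReal.ofReal (errorProb (πhat x t (v t)) i (ξ t i))
          ∂(hardInstance ε hε0 hε ξ).datasetLaw ρ (explorePolicy hn H) K := by
          rw [lintegral_finsetSum _ fun t _ => Finset.measurable_fun_sum _ fun i _ =>
            (hmeas' t i _).const_mul _]
          refine Finset.sum_congr rfl fun t _ => ?_
          rw [lintegral_finsetSum _ fun i _ => (hmeas' t i _).const_mul _]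
          exact Finset.sum_congr rfl fun i _ => (lintegral_const_mul _ (hmeas' t i _)).symm
      _ ≤ ∫⁻ x, ((hardInstance ε hε0 hε ξ).subOpt lam D (πhat x) s + ℓ)
          ∂(hardInstance ε hε0 hε ξ).datasetLaw ρ (explorePolicy hn H) K :=
          lintegral_mono fun x => ofReal_errorProb_le_subOpt hn hH ξ hlam D (πhat x) s
      _ ≤ _ := by
          rw [lintegral_add_right _ measurable_const, lintegral_const, measure_univ, mul_one]
          gcongr
          exact le_iSup (fun ξ : Fin H → Fin n → Bool =>
            ∫⁻ x, (hardInstance ε hε0 hε ξ).subOpt lam D (πhat x) s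
              ∂(hardInstance ε hε0 hε ξ).datasetLaw ρ (explorePolicy hn H) K) ξ
  have hcomb : N * (H * (n * c)) ≤ N * (4 * (R + ℓ)) := by
    calc N * (H * (n * c)) = ∑ _t : Fin H, ∑ _i : Fin n, c * N := by
          simp only [Finset.sum_const, Finset.card_univ, Fintype.card_fin, nsmul_eq_mul]
          ring
      _ ≤ ∑ t : Fin H, ∑ i : Fin n, c * (4 * ∑ ξ : Fin H → Fin n → Bool, ∫⁻ x,
          ENNReal.ofReal (errorProb (πhat x t (v t)) i (ξ t i))
            ∂(hardInstance ε hε0 hε ξ).datasetLaw ρ (explorePolicy hn H) K) := by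
          gcongr with t _ i _
          exact card_le_sum_lintegral_errorProb hn ρ hK _ (hmeas t) t i
      _ = 4 * ∑ ξ : Fin H → Fin n → Bool, ∑ t, ∑ i, c * ∫⁻ x,
          ENNReal.ofReal (errorProb (πhat x t (v t)) i (ξ t i))
            ∂(hardInstance ε hε0 hε ξ).datasetLaw ρ (explorePolicy hn H) K := by
          rw [Finset.sum_comm (s := (Finset.univ : Finset (Fin H → Fin n → Bool))), Finset.mul_sum]
          refine Finset.sum_congr rfl fun t _ => ?_
          rw [Finset.sum_comm (s := (Finset.univ : Finset (Fin H → Fin n → Bool))), Finset.mul_sum]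
          refine Finset.sum_congr rfl fun i _ => ?_
          rw [← Finset.mul_sum, mul_left_comm]
      _ ≤ 4 * ∑ _ξ : Fin H → Fin n → Bool, (R + ℓ) := by
          gcongr with ξ _
          exact hξ ξ
      _ = _ := by
          rw [Finset.sum_const, Finset.card_univ, nsmul_eq_mul]
          ring
  have hN0 : N ≠ 0 := by rw [hN]; exact_mod_cast Fintype.card_ne_zero
  have h4 := (ENNReal.mul_le_mul_iff_right hN0 (ENNReal.natCast_ne_top _)).1 hcomb
  have hn' : (n : ℝ) ≠ 0 := by exact_mod_cast hn.ne'
  refine (ENNReal.mul_le_mul_iff_right (a := 4) (by simp) (by simp)).1 (le_trans (le_of_eq ?_) h4)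
  rw [hc, ← ENNReal.ofReal_natCast H, ← ENNReal.ofReal_natCast n, ← ENNReal.ofReal_ofNat 4,
    ← ENNReal.ofReal_mul (by positivity), ← ENNReal.ofReal_mul (by positivity),
    ← ENNReal.ofReal_mul (by positivity)]
  congr 1
  field_simp
  ring

end Information

/-! ### Coverage and rates -/

section Coverage

variable {n H K : ℕ}

theorem hypercubeFeatures_probeAction_zero (s : Fin 2) (v : Fin (n + 1) → ℝ) :
    (hypercubeFeatures n).feat s (probeAction n 0) ⬝ᵥ v = v 0 := by
  rw [dotProduct, sum_hypercubeFeatures_mul]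
  simp [coordWeight, bit_probeAction_zero]

theorem hypercubeFeatures_probeAction_succ (s : Fin 2) (i : Fin n) (v : Fin (n + 1) → ℝ) :
    (hypercubeFeatures n).feat s (probeAction n i.succ) ⬝ᵥ v =
      v 0 + strength s / n * (v i.succ - v 0) := by
  rw [dotProduct, sum_hypercubeFeatures_mul]
  simp [coordWeight, bit_probeAction_succ]

/-- Each use of the action `b` adds at least `B - C` to the quadratic form of the Gram matrix. -/
theorem actionCount_mul_le (x : Dataset (Fin 2) (Fin (2 ^ n)) H K) (h : Fin H) (b : Fin (2 ^ n))
    (v : Fin (n + 1) → ℝ) {B C : ℝ}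
    (hB : ∀ s, B ≤ C + ((hypercubeFeatures n).feat s b ⬝ᵥ v) ^ 2) :
    actionCount x h b * (B - C) ≤ v ⬝ᵥ (gram (hypercubeFeatures n) x h).mulVec v := by
  rw [dotProduct_gram_mulVec, actionCount, ← nsmul_eq_mul, ← Finset.sum_const]
  have h0 : 0 ≤ v ⬝ᵥ v := Finset.sum_nonneg fun i _ => mul_self_nonneg _
  refine le_trans ?_ (le_add_of_nonneg_left h0)
  calc _ ≤ ∑ k ∈ Finset.univ.filter fun k => (x k h).1.2 = b,
        ((hypercubeFeatures n).feat (x k h).1.1 (x k h).1.2 ⬝ᵥ v) ^ 2 := by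
        refine Finset.sum_le_sum fun k hk => ?_
        rw [(Finset.mem_filter.1 hk).2]
        linarith [hB (x k h).1.1]
    _ ≤ _ := Finset.sum_le_sum_of_subset_of_nonneg (Finset.filter_subset _ _)
        fun k _ _ => sq_nonneg _

/-- If every probing action occurs at least `c` times at the step `h`, the Gram matrix dominates
`c / (16 n²)` times the square of each coordinate. -/
theorem sq_le_gram (hn : 0 < n) (x : Dataset (Fin 2) (Fin (2 ^ n)) H K) (h : Fin H) {c : ℝ}
    (hc : 0 < c) (hx : ∀ j, c ≤ actionCount x h (probeAction n j)) (i : Fin (n + 1))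
    (v : Fin (n + 1) → ℝ) :
    v i ^ 2 ≤ 16 * n ^ 2 / c * (v ⬝ᵥ (gram (hypercubeFeatures n) x h).mulVec v) := by
  have hn' : (1 : ℝ) ≤ n := by exact_mod_cast hn
  have hn2 : (1 : ℝ) ≤ n ^ 2 := one_le_pow₀ hn'
  set Q := v ⬝ᵥ (gram (hypercubeFeatures n) x h).mulVec v with hQ
  rw [div_mul_eq_mul_div, le_div_iff₀ hc]
  have hbase : c * v 0 ^ 2 ≤ Q := by
    have := actionCount_mul_le x h (probeAction n 0) v (B := v 0 ^ 2) (C := 0) fun s => by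
      rw [hypercubeFeatures_probeAction_zero, zero_add]
    rw [sub_zero] at this
    exact (mul_le_mul_of_nonneg_right (hx 0) (sq_nonneg _)).trans this
  have hQ0 : 0 ≤ Q := (mul_nonneg hc.le (sq_nonneg _)).trans hbase
  refine Fin.cases ?_ (fun i => ?_) i
  · nlinarith
  · -- In a sample that sets the bit `i`, `v i` is a combination of `v 0` and of the inner product with
    -- the feature, with coefficients at most `2 n`.
    have hcount := actionCount_mul_le x h (probeAction n i.succ) v
      (B := v i.succ ^ 2 / (8 * n ^ 2)) (C := v 0 ^ 2) fun s => by
        rw [hypercubeFeatures_probeAction_succ, div_le_iff₀ (by positivity)]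
        have h1 := half_le_strength s
        have h2 := strength_le_one s
        set σ := strength s
        set y := v 0 + σ / n * (v i.succ - v 0) with hy
        have hv : σ * v i.succ = n * y - (n - σ) * v 0 := by
          rw [hy]; field_simp; ring
        have hsq : (σ * v i.succ) ^ 2 ≤ 2 * n ^ 2 * (y ^ 2 + v 0 ^ 2) := by
          have h3 : ((n - σ) * v 0) ^ 2 ≤ n ^ 2 * v 0 ^ 2 := by
            rw [mul_pow]
            gcongr
            · linarith
            · linarith
          rw [hv]
          nlinarith [sq_nonneg (n * y + (n - σ) * v 0)]
        have hσ : 1 / 4 * v i.succ ^ 2 ≤ (σ * v i.succ) ^ 2 := by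
          rw [mul_pow]
          gcongr
          nlinarith
        linarith
    by_cases hle : v i.succ ^ 2 / (8 * n ^ 2) ≤ v 0 ^ 2
    · rw [div_le_iff₀ (by positivity)] at hle
      nlinarith [mul_le_mul_of_nonneg_left hbase (by positivity : (0 : ℝ) ≤ 8 * n ^ 2),
        mul_nonneg hc.le (sub_nonneg.2 hle)]
    · have h3 : c * (v i.succ ^ 2 / (8 * n ^ 2) - v 0 ^ 2) ≤ Q :=
        (mul_le_mul_of_nonneg_right (hx i.succ) (by linarith)).trans hcount
      have h4 : c * (v i.succ ^ 2 / (8 * n ^ 2)) ≤ 2 * Q := by linarith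
      rw [← mul_div_assoc, div_le_iff₀ (by positivity)] at h4
      linarith

/-- With high probability the dataset contains every probing action at every step at least half as
often as expected. -/
theorem one_sub_le_datasetLaw_actionCount (hn : 0 < n) (hH : 1 ≤ H)
    (M : LinearRRMDP (hypercubeFeatures n) H) (ρ : stdSimplex ℝ (Fin 2)) {δ : ℝ} (hδ : 0 < δ)
    (hK : 16 * n * Real.log ((n + 1) * H / δ) ≤ K) :
    ENNReal.ofReal (1 - δ) ≤ M.datasetLaw ρ (explorePolicy hn H) K
      {x | ∀ t j, (K : ℝ) / (4 * n) ≤ actionCount x t (probeAction n j)} := by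
  have hn' : (0 : ℝ) < n := by exact_mod_cast hn
  have hH' : (0 : ℝ) < H := by exact_mod_cast hH
  set Q := M.datasetLaw ρ (explorePolicy hn H) K
  set E := {x : Dataset (Fin 2) (Fin (2 ^ n)) H K |
    ∀ t j, (K : ℝ) / (4 * n) ≤ actionCount x t (probeAction n j)}
  have hcompl : Eᶜ = ⋃ (t : Fin H) (j : Fin (n + 1)), {x : Dataset (Fin 2) (Fin (2 ^ n)) H K |
      (actionCount x t (probeAction n j) : ℝ) < K * (1 / (2 * n)) / 2} := by
    ext x
    have : (K : ℝ) * (1 / (2 * n)) / 2 = K / (4 * n) := by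
      field_simp; norm_num
    rw [Set.mem_compl_iff, Set.mem_ofPred_eq]
    simp only [this, not_forall, not_le, Set.mem_iUnion, Set.mem_ofPred_eq]
  have hbad : Q Eᶜ ≤ ENNReal.ofReal δ := by
    calc Q Eᶜ ≤ ∑ t : Fin H, ∑ j : Fin (n + 1), Q {x : Dataset (Fin 2) (Fin (2 ^ n)) H K |
          (actionCount x t (probeAction n j) : ℝ) < K * (1 / (2 * n)) / 2} := by
          rw [hcompl]
          exact (measure_iUnion_fintype_le _ _).trans
            (Finset.sum_le_sum fun t _ => measure_iUnion_fintype_le _ _)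
      _ ≤ ∑ _t : Fin H, ∑ _j : Fin (n + 1),
          ENNReal.ofReal (Real.exp (-(K * (1 / (2 * n)) / 8))) := by
          gcongr with t _ j _
          exact M.datasetLaw_actionCount_lt_le ρ _ t _ (by positivity)
            fun s => le_explorePolicy hn t s j
      _ = ENNReal.ofReal ((n + 1) * H * Real.exp (-(K * (1 / (2 * n)) / 8))) := by
          simp only [Finset.sum_const, Finset.card_univ, Fintype.card_fin, nsmul_eq_mul]
          rw [← ENNReal.ofReal_natCast, ← ENNReal.ofReal_natCast,
            ← ENNReal.ofReal_mul (by positivity), ← ENNReal.ofReal_mul (by positivity)]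
          congr 1
          push_cast
          ring
      _ ≤ ENNReal.ofReal δ := by
          refine ENNReal.ofReal_le_ofReal ?_
          have hlog : Real.log ((n + 1) * H / δ) ≤ K * (1 / (2 * n)) / 8 := by
            have : (K : ℝ) * (1 / (2 * n)) / 8 = K / (16 * n) := by field_simp; ring
            rw [this, le_div_iff₀ (by positivity)]
            linarith
          have h1 : (n + 1) * H / δ ≤ Real.exp (K * (1 / (2 * n)) / 8) :=
            (Real.log_le_iff_le_exp (by positivity)).1 hlog
          rw [Real.exp_neg, ← div_eq_mul_inv, div_le_iff₀ (Real.exp_pos _)]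
          rw [div_le_iff₀ hδ] at h1
          linarith
  rw [ENNReal.ofReal_sub _ hδ.le, ENNReal.ofReal_one]
  refine tsub_le_iff_right.2 ?_
  calc 1 = Q Set.univ := measure_univ.symm
    _ ≤ Q E + Q Eᶜ := by rw [← Set.union_compl_self E]; exact measure_union_le _ _
    _ ≤ _ := by gcongr

end Coverage

section Regime

variable {d n H K : ℕ} {lam δ : ℝ}

/-- The separation of the hard instances: the scale `√(n³ / K)` at which a bit stays hidden, capped
to keep the rewards in `[0, 1]`. -/
noncomputable def separation (n K : ℕ) : ℝ := min (1 / 2) (Real.sqrt (n ^ 3 / K) / 4)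

theorem separation_nonneg (n K : ℕ) : 0 ≤ separation n K :=
  le_min (by norm_num) (by positivity)

theorem separation_le_half (n K : ℕ) : separation n K ≤ 1 / 2 := min_le_left _ _

theorem separation_sq_le (n K : ℕ) : 16 * (K * separation n K ^ 2) ≤ n ^ 3 := by
  have h1 : separation n K ^ 2 ≤ (Real.sqrt (n ^ 3 / K) / 4) ^ 2 :=
    pow_le_pow_left₀ (separation_nonneg n K) (min_le_right _ _) 2
  rw [div_pow, Real.sq_sqrt (by positivity)] at h1
  calc 16 * (K * separation n K ^ 2) ≤ 16 * (K * (n ^ 3 / K / 4 ^ 2)) := by gcongr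
    _ = n ^ 3 * (K / K : ℝ) := by ring
    _ ≤ n ^ 3 := mul_le_of_le_one_right (by positivity) (div_self_le_one _)

/-- The consequences of the lower bound on the sample size. -/
theorem regime (hn : 0 < n) (hH : 1 ≤ H) (hlam : 0 < lam) (hδ : 0 < δ) (hδ1 : δ < 1)
    (hK : 20000 * max (((n + 1 : ℕ) : ℝ) ^ 6) (((n + 1 : ℕ) : ℝ) ^ 3 * (H : ℝ) ^ 2 / lam ^ 2) *
      Real.log ((n + 1 : ℕ) * H / δ) < K) :
    0 < (K : ℝ) ∧ separation n K = Real.sqrt (n ^ 3 / K) / 4 ∧ 384 * separation n K ≤ lam ∧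
      16 * n * Real.log ((n + 1) * H / δ) ≤ K := by
  push_cast at hK
  have hn' : (1 : ℝ) ≤ n := by exact_mod_cast hn
  have hH' : (1 : ℝ) ≤ H := by exact_mod_cast hH
  set L := Real.log ((n + 1) * H / δ) with hL
  have hL2 : 1 / 2 ≤ L := by
    have h2 : (2 : ℝ) ≤ (n + 1) * H / δ := by
      rw [le_div_iff₀ hδ]; nlinarith
    linarith [Real.log_le_log (by norm_num) h2, Real.log_two_gt_d9]
  have hd3 : (n : ℝ) ^ 3 ≤ (n + 1) ^ 3 := by gcongr; linarith
  have hmax1 : ((n : ℝ) + 1) ^ 6 * L ≤ max (((n : ℝ) + 1) ^ 6)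
      (((n : ℝ) + 1) ^ 3 * H ^ 2 / lam ^ 2) * L := by gcongr; exact le_max_left _ _
  have hmax2 : (n : ℝ) ^ 3 / lam ^ 2 * (1 / 2) ≤ max (((n : ℝ) + 1) ^ 6)
      (((n : ℝ) + 1) ^ 3 * H ^ 2 / lam ^ 2) * L := by
    have h1 : (n : ℝ) ^ 3 / lam ^ 2 ≤ ((n : ℝ) + 1) ^ 3 * H ^ 2 / lam ^ 2 := by
      gcongr
      nlinarith [one_le_pow₀ hH' (n := 2), pow_pos (zero_lt_one.trans_le hn') 3]
    gcongr
    exact h1.trans (le_max_right _ _)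
  have hd6 : (n : ℝ) ^ 3 ≤ (n + 1) ^ 6 :=
    hd3.trans (pow_le_pow_right₀ (by linarith) (by norm_num))
  have hd1 : (n : ℝ) ≤ (n + 1) ^ 6 := by
    calc (n : ℝ) ≤ (n + 1) ^ 1 := by linarith
      _ ≤ _ := pow_le_pow_right₀ (by linarith) (by norm_num)
  have hn3 : (n : ℝ) ^ 3 * (1 / 2) ≤ (n + 1) ^ 6 * L := by gcongr
  have hnL : (n : ℝ) * L ≤ (n + 1) ^ 6 * L := by gcongr
  have hn3pos : (0 : ℝ) < n ^ 3 := by positivity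
  have hKpos : 0 < (K : ℝ) := by linarith
  refine ⟨hKpos, min_eq_right ?_, ?_, ?_⟩
  · have h1 : (n : ℝ) ^ 3 / K ≤ 1 := by rw [div_le_one hKpos]; linarith
    have := Real.sqrt_le_one.2 h1
    linarith
  · have hsq : (384 * separation n K) ^ 2 ≤ lam ^ 2 := by
      have h2 : 10000 * (n : ℝ) ^ 3 < K * lam ^ 2 := by
        have h3 : 10000 * ((n : ℝ) ^ 3 / lam ^ 2) < K := by linarith
        rwa [← mul_div_assoc, div_lt_iff₀ (by positivity)] at h3
      have h4 := separation_sq_le n K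
      have h5 : K * (384 * separation n K) ^ 2 ≤ K * lam ^ 2 := by nlinarith
      exact le_of_mul_le_mul_left h5 hKpos
    exact le_of_sq_le_sq hsq hlam.le
  · linarith [mul_nonneg (by linarith : (0 : ℝ) ≤ n) (by linarith : 0 ≤ L)]

/-- The rate in terms of `n = d - 1`. -/
theorem rate_le (hn : 0 < n) :
    (((n + 1 : ℕ) : ℝ) ^ (3 / 2 : ℝ) * H / Real.sqrt K) ≤ 3 * (H * Real.sqrt (n ^ 3 / K)) ∧
    H * Real.sqrt (n ^ 3 / K) ≤ ((n + 1 : ℕ) : ℝ) ^ (3 / 2 : ℝ) * H / Real.sqrt K := by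
  have hn' : (1 : ℝ) ≤ n := by exact_mod_cast hn
  have h32 : ((n + 1 : ℕ) : ℝ) ^ (3 / 2 : ℝ) = Real.sqrt ((n + 1) ^ 3) := by
    rw [Real.sqrt_eq_rpow, ← Real.rpow_natCast_mul (by positivity)]
    push_cast
    norm_num
  have hup : Real.sqrt (((n : ℝ) + 1) ^ 3) ≤ 3 * Real.sqrt (n ^ 3) := by
    rw [show (3 : ℝ) = Real.sqrt (3 ^ 2) by rw [Real.sqrt_sq (by norm_num)],
      ← Real.sqrt_mul (by norm_num)]
    refine Real.sqrt_le_sqrt ?_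
    calc ((n : ℝ) + 1) ^ 3 ≤ (2 * (n : ℝ)) ^ 3 := by gcongr; linarith
      _ = 8 * (n : ℝ) ^ 3 := by ring
      _ ≤ _ := by nlinarith [pow_pos (zero_lt_one.trans_le hn') 3]
  have hlow : Real.sqrt ((n : ℝ) ^ 3) ≤ Real.sqrt (((n : ℝ) + 1) ^ 3) :=
    Real.sqrt_le_sqrt (by gcongr; linarith)
  rw [h32, Real.sqrt_div (by positivity), mul_div_assoc]
  constructor
  · calc _ ≤ 3 * Real.sqrt (n ^ 3) * (H / Real.sqrt K) := by gcongr
      _ = _ := by ring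
  · calc _ = Real.sqrt (n ^ 3) * (H / Real.sqrt K) := by ring
      _ ≤ _ := by gcongr

end Regime

end RobustMDP

open RobustMDP in
theorem mainTheorem2 :
    ∃ c : ℝ, 0 < c ∧ ∃ C₀ : ℝ, 0 < C₀ ∧
      ∀ (d H K : ℕ) (lam : ℝ), 2 ≤ d → 1 ≤ H → 0 < lam →
        ∃ (nS nA : ℕ) (φ : RobustMDP.FeatureMap (Fin nS) (Fin nA) d)
          (C : Set (RobustMDP.LinearRRMDP φ H))
          (ρ : stdSimplex ℝ (Fin nS)) (πb : RobustMDP.Policy (Fin nS) (Fin nA) H),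
          ∀ δ : ℝ, 0 < δ → δ < 1 →
            C₀ * max ((d : ℝ) ^ 6) ((d : ℝ) ^ 3 * (H : ℝ) ^ 2 / lam ^ 2)
              * Real.log (d * H / δ) < K →
            ∀ (s : Fin nS) (D : RobustMDP.Divergence),
              ENNReal.ofReal (c * ((d : ℝ) ^ (3 / 2 : ℝ) * H / Real.sqrt K)) ≤
                RobustMDP.minimaxSubOpt C ρ πb K lam D s ∧
              ∀ M ∈ C, ∀ πstar : RobustMDP.Policy (Fin nS) (Fin nA) H,
                M.IsOptimal lam D πstar →
                ENNReal.ofReal (1 - δ) ≤ M.datasetLaw ρ πb K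
                  {x | ENNReal.ofReal c * RobustMDP.uncertainty M lam D πstar s x ≤
                      RobustMDP.minimaxSubOpt C ρ πb K lam D s ∧
                    ENNReal.ofReal c * RobustMDP.uncertainty M lam D πstar s x ≤
                      ENNReal.ofReal ((d : ℝ) ^ (3 / 2 : ℝ) * H / Real.sqrt K)} := by
  -- Assouad's lemma loses a factor `512 · 3` to the rate, and the uncertainty is at most `8` times it.
  refine ⟨1 / 12288, by norm_num, 20000, by norm_num, fun d H K lam hd hH hlam => ?_⟩
  obtain ⟨n, rfl⟩ : ∃ n, d = n + 1 := ⟨d - 1, by omega⟩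
  have hn : 0 < n := by omega
  refine ⟨2, 2 ^ n, hypercubeFeatures n, Set.range (hardInstance (separation n K)
    (separation_nonneg n K) (separation_le_half n K)), baseFactor, explorePolicy hn H,
    fun δ hδ hδ1 hK s D => ?_⟩
  obtain ⟨hKpos, hsep, hseplam, hKlog⟩ := regime hn hH hlam hδ hδ1 hK
  obtain ⟨hrate, hrate'⟩ := rate_le (H := H) (K := K) hn
  set X := ((n + 1 : ℕ) : ℝ) ^ (3 / 2 : ℝ) * H / Real.sqrt K with hX
  set R := minimaxSubOpt (Set.range (hardInstance (n := n) (H := H) (separation n K)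
    (separation_nonneg n K) (separation_le_half n K))) baseFactor (explorePolicy hn H) K lam D s
  have hX0 : 0 ≤ X := by positivity
  -- The per-step loss to robustness is at most half of the lower bound of Assouad's lemma.
  have hlow : ENNReal.ofReal (X / 1536) ≤ R := by
    have hR := le_minimaxSubOpt_add (H := H) (hε0 := separation_nonneg n K)
      (hε := separation_le_half n K) hn hH baseFactor (separation_sq_le n K) hlam D s
    have hloss : 3 * separation n K ^ 2 / lam ≤ separation n K / 128 := by
      rw [div_le_iff₀ hlam]
      nlinarith [separation_nonneg n K]
    have hHloss : H * (3 * separation n K ^ 2 / lam) ≤ H * (separation n K / 128) := by gcongr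
    have hle : X / 1536 ≤ H * separation n K / 64 - H * (3 * separation n K ^ 2 / lam) := by
      rw [hsep] at hHloss ⊢
      linarith
    calc ENNReal.ofReal (X / 1536) ≤ ENNReal.ofReal (H * separation n K / 64) -
          ENNReal.ofReal (H * (3 * separation n K ^ 2 / lam)) := by
          rw [← ENNReal.ofReal_sub _ (by positivity)]
          exact ENNReal.ofReal_le_ofReal hle
      _ ≤ R := tsub_le_iff_right.2 hR
  refine ⟨le_trans (ENNReal.ofReal_le_ofReal (by linarith)) hlow, fun M _ πstar _ => ?_⟩
  refine (one_sub_le_datasetLaw_actionCount hn hH M baseFactor hδ hKlog).trans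
    (measure_mono fun x hx => ?_)
  have hn' : (0 : ℝ) < n := by exact_mod_cast hn
  have hunc : ENNReal.ofReal (1 / 12288) * uncertainty M lam D πstar s x ≤
      ENNReal.ofReal (X / 1536) := by
    have h1 := uncertainty_le M lam D πstar s (x := x) (B := 64 * (n ^ 3 / K)) (by positivity)
      fun h i v => by
        have := sq_le_gram hn x h (c := K / (4 * n)) (by positivity) (hx h) i v
        rwa [show 16 * (n : ℝ) ^ 2 / (K / (4 * n)) = 64 * (n ^ 3 / K) by field_simp; norm_num]
          at this
    have h64 : Real.sqrt (64 * (n ^ 3 / K)) = 8 * Real.sqrt (n ^ 3 / K) := by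
      rw [Real.sqrt_mul (by norm_num), show (64 : ℝ) = 8 ^ 2 by norm_num,
        Real.sqrt_sq (by norm_num)]
    rw [h64] at h1
    calc _ ≤ ENNReal.ofReal (1 / 12288) * ENNReal.ofReal (H * (8 * Real.sqrt (n ^ 3 / K))) := by
          gcongr
      _ = ENNReal.ofReal (1 / 12288 * (H * (8 * Real.sqrt (n ^ 3 / K)))) :=
          (ENNReal.ofReal_mul (by norm_num)).symm
      _ ≤ _ := ENNReal.ofReal_le_ofReal (by linarith)
  exact ⟨hunc.trans hlow, hunc.trans (ENNReal.ofReal_le_ofReal (by linarith))⟩
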